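/- **Setting.** Let $n\ge 4$ and let $\mathbb R^{n+1}_1$ be Minkowski space with scalar product $x\cdot y=x_1y_1+\dots+x_ny_n-x_{n+1}y_{n+1}$; write $x^2=x\cdot x$. A space-like hypersurface is a smooth $n$-manifold $M$ with a smooth (possibly only immersed) position vector field $Z:M\to\mathbb R^{n+1}_1$ whose induced metric $g$ is positive definite. It is a *canal* hypersurface if there are a smooth function $\sigma:M\to\mathbb R$ with $d\sigma\neq0$ everywhere, whose level sets $\{\sigma=s\}$, $s\in J=\sigma(M)$, are called the generators, and points $z(s)\in\mathbb R^{n+1}_1$, $s\in J$, such that each generator is mapped by $Z$ into the cross-section of a space-like hypersphere $\{X:(X-c)^2=-\rho^2\}$, $\rho>0$, with a hyperplane, and the normals of $M$ at all points of the generator $\{\sigma=s\}$ pass through $z(s)$. Let $R(s)>0$ be the radius of the space-like hypersphere with center $z(s)$ containing this generator: $(Z-z(s))^2=-R(s)^2$ on $\{\sigma=s\}$. The canal hypersurface is of *elliptic type* if the curve of centers $z$ is smooth and time-like, $(dz/ds)^2<0$ on $J$. Let a prime denote differentiation with respect to the natural parameter of $z$, that is, $'=\big(-(dz/ds)^2\big)^{-1/2}\,d/ds$,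 and put $t=z'$ (so $t^2=-1$) and $N=-(Z-z)/R$. A Riemannian manifold $(M,g,\xi)$ with a smooth unit vector field $\xi$ is a *Riemannian QC-manifold* (of quasi-constant sectional curvatures) if the sectional curvature of a tangent plane $E\subset T_pM$ depends only on $p$ and the angle between $E$ and $\xi_p$. With $\eta=g(\xi,\cdot)$ put $$\pi(X,Y,W,U)=g(Y,W)g(X,U)-g(X,W)g(Y,U),$$ $$\Phi(X,Y,W,U)=g(Y,W)\eta(X)\eta(U)-g(X,W)\eta(Y)\eta(U)+g(X,U)\eta(Y)\eta(W)-g(Y,U)\eta(X)\eta(W).$$ Functions $a,b,k$ on $M$ with $b\ne0$ everywhere are the *curvature functions* of $(M,g,\xi)$ if the curvature tensor $\mathcal R(X,Y,W,U)=g(\nabla_X\nabla_YW-\nabla_Y\nabla_XW-\nabla_{[X,Y]}W,\,U)$ of the Levi-Civita connection $\nabla$ of $g$ is $\mathcal R=a\,\pi+b\,\Phi$, and $\nabla_x\xi=k\,x$ for all tangent vectors $x\perp\xi$, with $k=\xi(a)/(2b)$. **Proposition.** Let $M$ be a canal space-like hypersurface of elliptic type in $\mathbb R^{n+1}_1$.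 Then $R'^2-1>0$ on $J$; the vector field $$\xi=\frac{t-R'N}{\sqrt{R'^2-1}}$$ is a smooth unit tangent vector field of $M$; and $(M,g,\xi)$ is a Riemannian QC-manifold. It has curvature functions $a,b,k$, $b\neq0$, and they satisfy $$a=-\frac1{R^2}<0,\qquad a+k^2=\frac1{R^2(R'^2-1)}>0 ,$$ where $z,R,R',t$ are evaluated at $s=\sigma(p)$ for $p\in M$. -/

import Mathlib

open Bundle Set
open scoped Manifold ContDiff

noncomputable section

/-! ### Riemannian geometry: Levi-Civita connection, curvature, quasi-constant curvature -/

section Riemannian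

variable {n : ℕ} {M : Type*} [TopologicalSpace M] [ChartedSpace (EuclideanSpace ℝ (Fin n)) M]
  [IsManifold (𝓡 n) ∞ M]
  [RiemannianBundle (fun p : M ↦ TangentSpace (𝓡 n) p)]
  [IsContMDiffRiemannianBundle (𝓡 n) ∞ (EuclideanSpace ℝ (Fin n))
    (fun p : M ↦ TangentSpace (𝓡 n) p)]

set_option synthInstance.maxHeartbeats 400000 in
/-- An affine connection on the tangent bundle of a Riemannian manifold is the Levi-Civita
connection if it is compatible with the metric and torsion-free. (These two conditions determine
the connection on all differentiable vector fields.) -/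
def IsLeviCivita
    (cov : CovariantDerivative (𝓡 n) (EuclideanSpace ℝ (Fin n))
      (fun p : M ↦ TangentSpace (𝓡 n) p)) : Prop :=
  cov.IsMetricCompatible ∧ cov.torsion = 0

end Riemannian

section Curvature

variable {n : ℕ} {M : Type*} [TopologicalSpace M] [ChartedSpace (EuclideanSpace ℝ (Fin n)) M]
  [IsManifold (𝓡 n) ∞ M]

/-- The curvature operator of an affine connection on vector fields, at the point `p`:
`R(X, Y) W = ∇_X ∇_Y W - ∇_Y ∇_X W - ∇_[X, Y] W`. In Mathlib, `cov W p v` is `∇_v W`. -/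
def curvatureField
    (cov : CovariantDerivative (𝓡 n) (EuclideanSpace ℝ (Fin n))
      (fun p : M ↦ TangentSpace (𝓡 n) p))
    (X Y W : Π p : M, TangentSpace (𝓡 n) p) (p : M) : TangentSpace (𝓡 n) p :=
  cov (fun q ↦ cov W q (Y q)) p (X p) - cov (fun q ↦ cov W q (X q)) p (Y p)
    - cov W p (VectorField.mlieBracket (𝓡 n) X Y p)

/-- The curvature operator on tangent vectors `x, y, w` at `p`; the tangent vectors are extended
to vector fields that are smooth near `p`. The value does not depend on the extensions, since the
curvature of a smooth connection is tensorial. -/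
def curvatureOp
    (cov : CovariantDerivative (𝓡 n) (EuclideanSpace ℝ (Fin n))
      (fun p : M ↦ TangentSpace (𝓡 n) p))
    (p : M) (x y w : TangentSpace (𝓡 n) p) : TangentSpace (𝓡 n) p :=
  curvatureField cov (FiberBundle.extend (EuclideanSpace ℝ (Fin n)) x)
    (FiberBundle.extend (EuclideanSpace ℝ (Fin n)) y)
    (FiberBundle.extend (EuclideanSpace ℝ (Fin n)) w) p

variable [RiemannianBundle (fun p : M ↦ TangentSpace (𝓡 n) p)]

/-- The curvature tensor of type (0,4): `R(x, y, w, u) = g(R(x, y) w, u)`. -/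
def curvatureTensor
    (cov : CovariantDerivative (𝓡 n) (EuclideanSpace ℝ (Fin n))
      (fun p : M ↦ TangentSpace (𝓡 n) p))
    (p : M) (x y w u : TangentSpace (𝓡 n) p) : ℝ :=
  inner ℝ (curvatureOp cov p x y w) u

/-- The sectional curvature of the plane spanned by two linearly independent vectors `x, y`. -/
def sectionalCurvature
    (cov : CovariantDerivative (𝓡 n) (EuclideanSpace ℝ (Fin n))
      (fun p : M ↦ TangentSpace (𝓡 n) p))
    (p : M) (x y : TangentSpace (𝓡 n) p) : ℝ :=
  curvatureTensor cov p x y y x / (inner ℝ x x * inner ℝ y y - inner ℝ x y ^ 2)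

/-- The angle (in `[0, π/2]`) between a tangent vector `v` and the plane `span {x, y}`, i.e. the
angle between `v` and its orthogonal projection to the plane (a right angle if this projection
is zero). -/
def anglePlane {p : M} (v x y : TangentSpace (𝓡 n) p) : ℝ :=
  haveI : FiniteDimensional ℝ (Submodule.span ℝ {x, y}) :=
    FiniteDimensional.span_of_finite ℝ (by simp)
  InnerProductGeometry.angle v ((Submodule.span ℝ {x, y}).starProjection v)

/-- The tensor `π(x, y, w, u) = g(y, w) g(x, u) - g(x, w) g(y, u)`. -/
def tensorPi {p : M} (x y w u : TangentSpace (𝓡 n) p) : ℝ :=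
  inner ℝ y w * inner ℝ x u - inner ℝ x w * inner ℝ y u

/-- The tensor `Φ(x, y, w, u) = g(y, w) η(x) η(u) - g(x, w) η(y) η(u) + g(x, u) η(y) η(w)
- g(y, u) η(x) η(w)`, where `η = g(ξ, ·)`. -/
def tensorPhi {p : M} (ξ x y w u : TangentSpace (𝓡 n) p) : ℝ :=
  inner ℝ y w * inner ℝ ξ x * inner ℝ ξ u - inner ℝ x w * inner ℝ ξ y * inner ℝ ξ u
    + inner ℝ x u * inner ℝ ξ y * inner ℝ ξ w - inner ℝ y u * inner ℝ ξ x * inner ℝ ξ w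

end Curvature

section QC

variable {n : ℕ} {M : Type*} [TopologicalSpace M] [ChartedSpace (EuclideanSpace ℝ (Fin n)) M]
  [IsManifold (𝓡 n) ∞ M]
  [RiemannianBundle (fun p : M ↦ TangentSpace (𝓡 n) p)]
  [IsContMDiffRiemannianBundle (𝓡 n) ∞ (EuclideanSpace ℝ (Fin n))
    (fun p : M ↦ TangentSpace (𝓡 n) p)]

/-- `(M, g, ξ)`, with Levi-Civita connection `cov`, is a Riemannian manifold of quasi-constant
sectional curvatures (a Riemannian QC-manifold): `ξ` is a smooth unit vector field, and the
sectional curvature of a tangent plane depends only on the point and on the angle between the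
plane and `ξ`. -/
structure IsQCManifold
    (cov : CovariantDerivative (𝓡 n) (EuclideanSpace ℝ (Fin n))
      (fun p : M ↦ TangentSpace (𝓡 n) p))
    (ξ : Π p : M, TangentSpace (𝓡 n) p) : Prop where
  leviCivita : IsLeviCivita cov
  smooth : ContMDiff (𝓡 n) ((𝓡 n).prod 𝓘(ℝ, EuclideanSpace ℝ (Fin n))) ∞
    (fun p ↦ TotalSpace.mk' (EuclideanSpace ℝ (Fin n)) p (ξ p))
  unit : ∀ p, inner ℝ (ξ p) (ξ p) = (1 : ℝ)
  sectional : ∃ K : M → ℝ → ℝ, ∀ (p : M) (x y : TangentSpace (𝓡 n) p),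
    LinearIndependent ℝ ![x, y] → sectionalCurvature cov p x y = K p (anglePlane (ξ p) x y)

/-- The functions `a`, `b`, `k` of a Riemannian QC-manifold without points of constant sectional
curvature: the curvature tensor is `a π + b Φ` with `b ≠ 0`, and `∇_x ξ = k x` for all tangent
vectors `x` orthogonal to `ξ`, where `k = ξ(a) / (2 b)`. -/
structure AreQCFunctions
    (cov : CovariantDerivative (𝓡 n) (EuclideanSpace ℝ (Fin n))
      (fun p : M ↦ TangentSpace (𝓡 n) p))
    (ξ : Π p : M, TangentSpace (𝓡 n) p) (a b k : M → ℝ) : Prop where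
  curvature : ∀ (p : M) (x y w u : TangentSpace (𝓡 n) p),
    curvatureTensor cov p x y w u = a p * tensorPi x y w u + b p * tensorPhi (ξ p) x y w u
  b_ne_zero : ∀ p, b p ≠ 0
  umbilical : ∀ (p : M) (x : TangentSpace (𝓡 n) p), inner ℝ (ξ p) x = (0 : ℝ) →
    cov ξ p x = k p • x
  k_eq : ∀ p, k p = mvfderiv (𝓡 n) a p (ξ p) / (2 * b p)

end QC

/-! ### Space-like hypersurfaces of Minkowski space -/

/-- Minkowski space `ℝⁿ⁺¹₁ = ℝⁿ × ℝ`; the last coordinate is the time coordinate. -/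
abbrev Minkowski (n : ℕ) : Type := EuclideanSpace ℝ (Fin n) × ℝ

/-- The Minkowski scalar product `x₁ y₁ + ⋯ + xₙ yₙ - xₙ₊₁ yₙ₊₁`. -/
def mink {n : ℕ} (x y : Minkowski n) : ℝ := inner ℝ x.1 y.1 - x.2 * y.2

section Hypersurfaces

variable {n : ℕ} {M : Type*} [TopologicalSpace M] [ChartedSpace (EuclideanSpace ℝ (Fin n)) M]

/-- `Z : M → ℝⁿ⁺¹₁` is the position vector field of a (possibly immersed) space-like
hypersurface: `Z` is smooth and the Riemannian (hence positive definite) metric of `M` is the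
metric induced by `Z`. In particular every `dZ_p` is injective. -/
structure IsSpacelikeHypersurface [RiemannianBundle (fun p : M ↦ TangentSpace (𝓡 n) p)]
    (Z : M → Minkowski n) : Prop where
  smooth : ContMDiff (𝓡 n) 𝓘(ℝ, Minkowski n) ∞ Z
  induced : ∀ (p : M) (v w : TangentSpace (𝓡 n) p),
    (inner ℝ v w : ℝ) = mink (mvfderiv (𝓡 n) Z p v) (mvfderiv (𝓡 n) Z p w)

/-- The space-like hypersphere `(X - c)² = -ρ²`. -/
def spacelikeHypersphere {n : ℕ} (c : Minkowski n) (ρ : ℝ) : Set (Minkowski n) :=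
  {X | mink (X - c) (X - c) = -ρ ^ 2}

/-- The hyperplane `m · X = d`; every affine hyperplane has this form with `m ≠ 0`. -/
def hyperplane {n : ℕ} (m : Minkowski n) (d : ℝ) : Set (Minkowski n) :=
  {X | mink m X = d}

/-- The normal line of the hypersurface `Z` at `p` passes through the point `c`. -/
def NormalPassesThrough (Z : M → Minkowski n) (p : M) (c : Minkowski n) : Prop :=
  ∀ v : TangentSpace (𝓡 n) p, mink (c - Z p) (mvfderiv (𝓡 n) Z p v) = 0

/-- The hypersurface `Z` is canal, with generator parameter `σ` and centers `z(s)`: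
it is a regular one-parameter family of generators `{p | σ p = s}`, every generator lies in a
sphere of codimension two (the cross-section of a space-like hypersphere with a hyperplane), and
the normals of the hypersurface at the points of the generator with parameter `s` pass through
the point `z(s)`. -/
structure IsCanal (Z : M → Minkowski n) (σ : M → ℝ) (z : ℝ → Minkowski n) : Prop where
  smooth_param : ContMDiff (𝓡 n) 𝓘(ℝ, ℝ) ∞ σ
  regular_param : ∀ p, mvfderiv (𝓡 n) σ p ≠ 0
  spherical : ∀ s ∈ range σ, ∃ (c : Minkowski n) (ρ : ℝ) (m : Minkowski n) (d : ℝ),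
    0 < ρ ∧ m ≠ 0 ∧ ∀ p, σ p = s → Z p ∈ spacelikeHypersphere c ρ ∩ hyperplane m d
  normals : ∀ p, NormalPassesThrough Z p (z (σ p))

/-- `R(s) > 0` is the radius of the space-like hypersphere with center `z(s)` containing the
generator with parameter `s`. -/
def IsRadius (Z : M → Minkowski n) (σ : M → ℝ) (z : ℝ → Minkowski n) (R : ℝ → ℝ) : Prop :=
  ∀ p, 0 < R (σ p) ∧ Z p ∈ spacelikeHypersphere (z (σ p)) (R (σ p))

end Hypersurfaces

/-- `z` is a smooth time-like curve on the open set `J` of parameters. -/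
def IsTimelikeCurveOn {n : ℕ} (z : ℝ → Minkowski n) (J : Set ℝ) : Prop :=
  ContDiffOn ℝ ∞ z J ∧ ∀ s ∈ J, mink (deriv z s) (deriv z s) < 0

/-- The speed `√(-z'²)` of a time-like curve; it is the derivative of the natural parameter. -/
def speed {n : ℕ} (z : ℝ → Minkowski n) (s : ℝ) : ℝ :=
  √(-mink (deriv z s) (deriv z s))

/-- The unit tangent vector of a time-like curve, i.e. the derivative of `z` with respect to the
natural parameter. -/
def unitTangent {n : ℕ} (z : ℝ → Minkowski n) (s : ℝ) : Minkowski n :=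
  (speed z s)⁻¹ • deriv z s

/-- The derivative of `R` with respect to the natural parameter of the time-like curve `z`. -/
def derivNatural {n : ℕ} (z : ℝ → Minkowski n) (R : ℝ → ℝ) (s : ℝ) : ℝ :=
  deriv R s / speed z s

end

/-! Put G = t - R'N, so that ξ = G / √(R'² - 1), let η = g(ξ, ·), and let v denote the speed of z.
Everything comes from differentiating R N = z - Z: for tangent x, R dN(x) = -dZ(x) + v dσ(x) G
(`mvfderiv_canalNormal`). Pairing this with N, where N·N = -1, gives N·G = 0. Hence G is tangent,
t·N = -R' and G² = R'² - 1. Tangent vectors are space-like, so R'² ≥ 1. Equality at one point would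
make G vanish on the whole generator, although in the generator directions dG = (R'/R) dZ, which is
then injective (`derivNatural_radius_sq_sub_one_pos`).

Differentiating t·N = -R' shows that dσ = c g(G, ·) with c ≠ 0 (`exists_mvfderiv_param_eq`). The
second fundamental form dN·dZ is therefore (-g + β η⊗η)/R with β = v c (R'² - 1). The Levi-Civita
connection is the tangential part of the ambient derivative, and its Gauss equation for a time-like
normal (`curvatureTensor_inducedConnection`) turns this form into a π + b Φ with a = -1/R² and b =
β/R², because the terms quartic in η cancel. A plane at angle θ to ξ then has sectional curvature a
+ b cos² θ.

A vector x orthogonal to ξ satisfies dσ(x) = 0, so only dG contributes to ∇_x ξ, and k = R' / (R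
√(R'² - 1)). The formula for a + k² is then arithmetic. The relation ξ(a) = 2 b k holds because a
depends on σ only and dσ(ξ) = c √(R'² - 1). -/

open scoped Topology

/-! ### Differentials along vector fields and Lie brackets in charts. -/

section Calculus

variable {E : Type*} [NormedAddCommGroup E] [NormedSpace ℝ E] {H : Type*} [TopologicalSpace H]
  {I : ModelWithCorners ℝ E H} {M : Type*} [TopologicalSpace M] [ChartedSpace H M]
  {F : Type*} [NormedAddCommGroup F] [NormedSpace ℝ F]

/-- The differential of `f`, read in the tangent bundle trivialization at `p`, is smooth. -/
theorem ContMDiffAt.mvfderiv_comp_symmL [IsManifold I 1 M] {m k : ℕ∞ω} [IsManifold I k M]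
    {f : M → F} {p : M} (hf : ContMDiffAt I 𝓘(ℝ, F) k f p) (hm : m + 1 ≤ k) :
    ContMDiffAt I 𝓘(ℝ, E →L[ℝ] F) m (fun q ↦ mvfderiv I f q ∘L
      (trivializationAt E (TangentSpace I) p).symmL ℝ q) p := by
  refine (hf.mfderiv_const hm).congr_of_eventuallyEq (.of_forall fun q ↦ ?_)
  simp only [inTangentCoordinates, ContinuousLinearMap.inCoordinates]
  rw [TangentBundle.continuousLinearMapAt_model_space]
  rfl

theorem ContMDiffAt.mvfderiv_apply [IsManifold I 1 M] {m k : ℕ∞ω} [IsManifold I k M]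
    {f : M → F} {p : M} (hf : ContMDiffAt I 𝓘(ℝ, F) k f p) (hm : m + 1 ≤ k)
    {X : Π q : M, TangentSpace I q}
    (hX : ContMDiffAt I (I.prod 𝓘(ℝ, E)) m (fun q ↦ TotalSpace.mk' E q (X q)) p) :
    ContMDiffAt I 𝓘(ℝ, F) m (fun q ↦ mvfderiv I f q (X q)) p := by
  have hX' := (contMDiffAt_section p).1 hX
  refine ((hf.mvfderiv_comp_symmL hm).clm_apply hX').congr_of_eventuallyEq ?_
  set e := trivializationAt E (TangentSpace I) p
  filter_upwards [e.open_baseSet.mem_nhds (FiberBundle.mem_baseSet_trivializationAt' p)] with q hq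
  rw [ContinuousLinearMap.comp_apply, ← e.continuousLinearMapAt_apply_of_mem ℝ hq,
     e.symmL_continuousLinearMapAt hq]

/-- The version for fields that are only differentiable: metric compatibility and vanishing torsion
have to be tested on such fields. -/
theorem ContMDiffAt.mdifferentiableAt_mvfderiv_apply [IsManifold I 1 M] [IsManifold I 2 M]
    {f : M → F} {p : M} (hf : ContMDiffAt I 𝓘(ℝ, F) 2 f p) {X : Π q : M, TangentSpace I q}
    (hX : MDifferentiableAt I (I.prod 𝓘(ℝ, E)) (fun q ↦ TotalSpace.mk' E q (X q)) p) :
    MDifferentiableAt I 𝓘(ℝ, F) (fun q ↦ mvfderiv I f q (X q)) p := by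
  have hX' := (mdifferentiableAt_section I X).1 hX
  have hL := (hf.mvfderiv_comp_symmL (m := 1)
    (by norm_num [one_add_one_eq_two])).mdifferentiableAt one_ne_zero
  refine (hL.clm_apply hX').congr_of_eventuallyEq ?_
  set e := trivializationAt E (TangentSpace I) p
  filter_upwards [e.open_baseSet.mem_nhds (FiberBundle.mem_baseSet_trivializationAt' p)] with q hq
  rw [ContinuousLinearMap.comp_apply, ← e.continuousLinearMapAt_apply_of_mem ℝ hq,
     e.symmL_continuousLinearMapAt hq]

/-- The differential of `f ∘ φ⁻¹`, where `φ` is the chart at `p`. -/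
theorem mvfderiv_mfderiv_extChartAt_symm [I.Boundaryless] [IsManifold I 1 M] {f : M → F} {p : M}
    {y : E} (hy : y ∈ (extChartAt I p).target)
    (hf : MDifferentiableAt I 𝓘(ℝ, F) f ((extChartAt I p).symm y)) (v : E) :
    mvfderiv I f ((extChartAt I p).symm y) (mfderiv 𝓘(ℝ, E) I (extChartAt I p).symm y v) =
      fderiv ℝ (f ∘ (extChartAt I p).symm) y v := by
  have hs := mdifferentiableWithinAt_extChartAt_symm (I := I) hy
  rw [I.range_eq_univ, mdifferentiableWithinAt_univ] at hs
  rw [← mfderiv_eq_fderiv, mfderiv_comp y hf hs]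
  rfl

theorem mvfderiv_apply_eq_fderiv_extChartAt [I.Boundaryless] [IsManifold I 1 M] {f : M → F} {p : M}
    (hf : MDifferentiableAt I 𝓘(ℝ, F) f p) (v : TangentSpace I p) :
    mvfderiv I f p v = fderiv ℝ (f ∘ (extChartAt I p).symm) (extChartAt I p p)
      (mfderiv I 𝓘(ℝ, E) (extChartAt I p) p v) := by
  have hs := mdifferentiableWithinAt_extChartAt_symm (I := I) (mem_extChartAt_target p)
  rw [I.range_eq_univ, mdifferentiableWithinAt_univ] at hs
  have hc := MDifferentiableAt.comp (extChartAt I p p) (by rwa [extChartAt_to_inv p]) hs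
  have h1 : f =ᶠ[𝓝 p] (f ∘ (extChartAt I p).symm) ∘ extChartAt I p := by
    filter_upwards [extChartAt_source_mem_nhds (I := I) p] with q hq
    exact congrArg f ((extChartAt I p).left_inv hq).symm
  have h2 := mfderiv_comp p hc (mdifferentiableAt_extChartAt (I := I) (mem_chart_source H p))
  rw [← h1.mfderiv_eq, mfderiv_eq_fderiv] at h2
  exact congrArg (fun L ↦ L v) h2

variable (I) in
/-- The coordinate expression of a vector field in the chart at `p`. -/
noncomputable def coordField (p : M) (X : Π q : M, TangentSpace I q) : E → E :=
  VectorField.mpullbackWithin 𝓘(ℝ, E) I (extChartAt I p).symm X (range I)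

/-- The differential of a function in the direction of a vector field, computed in a chart. -/
theorem mvfderiv_extChartAt_symm_apply [I.Boundaryless] [IsManifold I 1 M] {f : M → F} {p : M}
    {y : E} (hy : y ∈ (extChartAt I p).target)
    (hf : MDifferentiableAt I 𝓘(ℝ, F) f ((extChartAt I p).symm y)) (X : Π q : M, TangentSpace I q) :
    mvfderiv I f ((extChartAt I p).symm y) (X ((extChartAt I p).symm y)) =
      fderiv ℝ (f ∘ (extChartAt I p).symm) y (coordField I p X y) := by
  have hi := isInvertible_mfderivWithin_extChartAt_symm (I := I) hy
  rw [coordField, VectorField.mpullbackWithin_apply]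
  rw [I.range_eq_univ, mfderivWithin_univ] at hi ⊢
  refine Eq.trans ?_ (mvfderiv_mfderiv_extChartAt_symm hy hf _)
  congr 1
  obtain ⟨e, he⟩ := hi
  rw [← he, ContinuousLinearMap.inverse_equiv]
  exact (e.apply_symm_apply _).symm

theorem differentiableAt_coordField [I.Boundaryless] [IsManifold I 2 M] [IsManifold I 1 M]
    [CompleteSpace E] {p : M} {X : Π q : M, TangentSpace I q}
    (hX : MDifferentiableAt I (I.prod 𝓘(ℝ, E)) (fun q ↦ TotalSpace.mk' E q (X q)) p) :
    DifferentiableAt ℝ (coordField I p X) (extChartAt I p p) := by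
  have : DifferentiableWithinAt ℝ (coordField I p X) _ (extChartAt I p p) :=
    (hX.mdifferentiableWithinAt (s := univ)).differentiableWithinAt_mpullbackWithin_vectorField
  rwa [preimage_univ, univ_inter, I.range_eq_univ, differentiableWithinAt_univ] at this

theorem mfderiv_extChartAt_mlieBracket [I.Boundaryless] [IsManifold I 1 M] (p : M)
    (X Y : Π q : M, TangentSpace I q) :
    mfderiv I 𝓘(ℝ, E) (extChartAt I p) p (VectorField.mlieBracket I X Y p) =
      VectorField.lieBracket ℝ (coordField I p X) (coordField I p Y) (extChartAt I p p) := by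
  obtain ⟨e, he⟩ := isInvertible_mfderiv_extChartAt (I := I) (mem_extChartAt_source (I := I) p)
  have h : VectorField.mlieBracket I X Y p =
      (mfderiv I 𝓘(ℝ, E) (extChartAt I p) p).inverse (VectorField.lieBracketWithin (E := E) ℝ
        (coordField I p X) (coordField I p Y) ((extChartAt I p).symm ⁻¹' univ ∩ range I)
        (extChartAt I p p)) := rfl
  rw [h, ← he, ContinuousLinearMap.inverse_equiv, preimage_univ, univ_inter, I.range_eq_univ,
    VectorField.lieBracketWithin_univ]
  exact e.apply_symm_apply _

/-- The second-order terms of the two iterated derivatives cancel by symmetry of the second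
derivative of `g`; what remains is the derivative along the bracket. -/
theorem fderiv_lieBracket_apply {g : E → F} {x : E} (hg : ContDiffAt ℝ 2 g x) {U W : E → E}
    (hU : DifferentiableAt ℝ U x) (hW : DifferentiableAt ℝ W x) :
    fderiv ℝ g x (VectorField.lieBracket ℝ U W x) =
      fderiv ℝ (fun y ↦ fderiv ℝ g y (W y)) x (U x) -
        fderiv ℝ (fun y ↦ fderiv ℝ g y (U y)) x (W x) := by
  have hd : DifferentiableAt ℝ (fderiv ℝ g) x :=
    (hg.fderiv_right (m := 1) (by norm_num [one_add_one_eq_two])).differentiableAt one_ne_zero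
  have hs := (hg.isSymmSndFDerivAt (by simp)).eq (U x) (W x)
  rw [fderiv_clm_apply hd hW, fderiv_clm_apply hd hU, VectorField.lieBracket_eq]
  simp [hs]

/-- The derivative along a Lie bracket is the commutator of the derivatives. -/
theorem mvfderiv_mlieBracket [I.Boundaryless] [IsManifold I 2 M] [IsManifold I 1 M]
    [CompleteSpace E]
    {f : M → F} {p : M} (hf : ContMDiffAt I 𝓘(ℝ, F) 2 f p) {X Y : Π q : M, TangentSpace I q}
    (hX : MDifferentiableAt I (I.prod 𝓘(ℝ, E)) (fun q ↦ TotalSpace.mk' E q (X q)) p)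
    (hY : MDifferentiableAt I (I.prod 𝓘(ℝ, E)) (fun q ↦ TotalSpace.mk' E q (Y q)) p) :
    mvfderiv I f p (VectorField.mlieBracket I X Y p) =
      mvfderiv I (fun q ↦ mvfderiv I f q (Y q)) p (X p) -
        mvfderiv I (fun q ↦ mvfderiv I f q (X q)) p (Y p) := by
  set φ := extChartAt I p with hφ
  have hxt : φ p ∈ φ.target := mem_extChartAt_target p
  have hxp : φ.symm (φ p) = p := extChartAt_to_inv p
  have htn : φ.target ∈ 𝓝 (φ p) := extChartAt_target_mem_nhds p
  have hsymm : ContMDiffAt 𝓘(ℝ, E) I 2 φ.symm (φ p) :=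
    (contMDiffOn_extChartAt_symm p).contMDiffAt htn
  have hfc : ContDiffAt ℝ 2 (f ∘ φ.symm) (φ p) := by
    rw [← contMDiffAt_iff_contDiffAt]
    exact ContMDiffAt.comp _ (by rwa [hxp]) hsymm
  have hf' : ∀ᶠ y in 𝓝 (φ p), MDifferentiableAt I 𝓘(ℝ, F) f (φ.symm y) := by
    have h1 : ∀ᶠ q in 𝓝 (φ.symm (φ p)), ContMDiffAt I 𝓘(ℝ, F) 2 f q := by
      rw [hxp]; exact (contMDiffAt_iff_contMDiffAt_nhds (by simp)).1 hf
    filter_upwards [hsymm.continuousAt.eventually h1] with y hy using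
      hy.mdifferentiableAt two_ne_zero
  -- Both iterated derivatives are moved to the chart at `p`, where the identity is the one for
  -- vector spaces.
  have key : ∀ {U W : Π q : M, TangentSpace I q},
      MDifferentiableAt I (I.prod 𝓘(ℝ, E)) (fun q ↦ TotalSpace.mk' E q (W q)) p →
      mvfderiv I (fun q ↦ mvfderiv I f q (W q)) p (U p) =
        fderiv ℝ (fun y ↦ fderiv ℝ (f ∘ φ.symm) y (coordField I p W y)) (φ p)
          (coordField I p U (φ p)) := by
    intro U W hW
    have hm := hf.mdifferentiableAt_mvfderiv_apply hW
    have h1 := mvfderiv_extChartAt_symm_apply (f := fun q ↦ mvfderiv I f q (W q)) hxt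
      (by rwa [← hφ, hxp]) U
    rw [← hφ, hxp] at h1
    rw [h1]
    congr 1
    refine Filter.EventuallyEq.fderiv_eq ?_
    filter_upwards [htn, hf'] with y hy hy'
    exact mvfderiv_extChartAt_symm_apply hy hy' W
  rw [key hY, key hX, ← fderiv_lieBracket_apply hfc (differentiableAt_coordField hX)
    (differentiableAt_coordField hY), hφ, ← mfderiv_extChartAt_mlieBracket]
  exact mvfderiv_apply_eq_fderiv_extChartAt (hf.mdifferentiableAt two_ne_zero) _

end Calculus

/-! ### Chain and product rules; level sets and local sections of a function. -/

section Calculus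

variable {E : Type*} [NormedAddCommGroup E] [NormedSpace ℝ E] {H : Type*} [TopologicalSpace H]
  {I : ModelWithCorners ℝ E H} {M : Type*} [TopologicalSpace M] [ChartedSpace H M]
  {F : Type*} [NormedAddCommGroup F] [NormedSpace ℝ F]
  {F' : Type*} [NormedAddCommGroup F'] [NormedSpace ℝ F']

theorem mvfderiv_fderiv_comp {g : F → F'} {f : M → F} {p : M} (hg : DifferentiableAt ℝ g (f p))
    (hf : MDifferentiableAt I 𝓘(ℝ, F) f p) (v : TangentSpace I p) :
    mvfderiv I (fun q ↦ g (f q)) p v = fderiv ℝ g (f p) (mvfderiv I f p v) := by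
  have h := mfderiv_comp p hg.mdifferentiableAt hf
  rw [mfderiv_eq_fderiv] at h
  exact congrArg (fun L ↦ L v) h

theorem mvfderiv_deriv_comp {g : ℝ → F} {f : M → ℝ} {p : M} (hg : DifferentiableAt ℝ g (f p))
    (hf : MDifferentiableAt I 𝓘(ℝ, ℝ) f p) (v : TangentSpace I p) :
    mvfderiv I (fun q ↦ g (f q)) p v = mvfderiv I f p v • deriv g (f p) := by
  rw [mvfderiv_fderiv_comp hg hf, fderiv_eq_smul_deriv]

/-- The product rule for a continuous bilinear map. -/
theorem mvfderiv_bilin {G : Type*} [NormedAddCommGroup G] [NormedSpace ℝ G]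
    (B : F →L[ℝ] F' →L[ℝ] G) {f : M → F} {g : M → F'} {p : M}
    (hf : MDifferentiableAt I 𝓘(ℝ, F) f p) (hg : MDifferentiableAt I 𝓘(ℝ, F') g p)
    (v : TangentSpace I p) :
    mvfderiv I (fun q ↦ B (f q) (g q)) p v =
      B (f p) (mvfderiv I g p v) + B (mvfderiv I f p v) (g p) := by
  have hB : HasFDerivAt (fun x : F × F' ↦ B x.1 x.2) (B.deriv₂ (f p, g p))
      (f p, g p) :=
    B.hasFDerivAt_of_bilinear (hasFDerivAt_fst (p := (f p, g p))) hasFDerivAt_snd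
  have h := mvfderiv_fderiv_comp (I := I) (g := fun x : F × F' ↦ B x.1 x.2)
    (f := fun q ↦ (f q, g q)) (p := p) hB.differentiableAt (hf.prodMk_space hg) v
  rw [h, hB.fderiv]
  have h2 : mvfderiv I (fun q ↦ (f q, g q)) p v = (mvfderiv I f p v, mvfderiv I g p v) := by
    refine Prod.ext ?_ ?_
    · have := mvfderiv_fderiv_comp (I := I) (g := ContinuousLinearMap.fst ℝ F F')
        (f := fun q ↦ (f q, g q)) (p := p) (by fun_prop) (hf.prodMk_space hg) v
      rw [ContinuousLinearMap.fderiv] at this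
      exact this.symm
    · have := mvfderiv_fderiv_comp (I := I) (g := ContinuousLinearMap.snd ℝ F F')
        (f := fun q ↦ (f q, g q)) (p := p) (by fun_prop) (hf.prodMk_space hg) v
      rw [ContinuousLinearMap.fderiv] at this
      exact this.symm
  rw [h2]
  simp

/-- A function which vanishes on a regular level set of `σ` has zero derivative in the directions
tangent to the level set. -/
theorem mvfderiv_eq_zero_of_eqOn_level [CompleteSpace E] [I.Boundaryless] [IsManifold I 1 M]
    {f σ : M → ℝ} {p : M}
    (hf : ContMDiffAt I 𝓘(ℝ, ℝ) 1 f p) (hσ : ContMDiffAt I 𝓘(ℝ, ℝ) 1 σ p)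
    (hσp : mvfderiv I σ p ≠ 0) (h : ∀ q, σ q = σ p → f q = f p) (v : TangentSpace I p)
    (hv : mvfderiv I σ p v = 0) : mvfderiv I f p v = 0 := by
  set φ := extChartAt I p with hφ
  have hxt : φ p ∈ φ.target := mem_extChartAt_target p
  have hxp : φ.symm (φ p) = p := extChartAt_to_inv p
  have htn : φ.target ∈ 𝓝 (φ p) := extChartAt_target_mem_nhds p
  have hsymm : ContMDiffAt 𝓘(ℝ, E) I 1 φ.symm (φ p) :=
    (contMDiffOn_extChartAt_symm p).contMDiffAt htn
  have hc : ∀ {g : M → ℝ}, ContMDiffAt I 𝓘(ℝ, ℝ) 1 g p → HasStrictFDerivAt (g ∘ φ.symm)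
      (fderiv ℝ (g ∘ φ.symm) (φ p)) (φ p) := by
    intro g hg
    have : ContDiffAt ℝ 1 (g ∘ φ.symm) (φ p) := by
      rw [← contMDiffAt_iff_contDiffAt]
      exact ContMDiffAt.comp _ (by rwa [hxp]) hsymm
    exact this.hasStrictFDerivAt one_ne_zero
  -- Being constant on the level set, `f` has a constrained minimum at `p`, so Lagrange multipliers
  -- give a dσ + b df = 0. Regularity of σ excludes b = 0.
  have hext : IsLocalExtrOn (f ∘ φ.symm) {x | (σ ∘ φ.symm) x = (σ ∘ φ.symm) (φ p)} (φ p) := by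
    left
    refine Filter.eventually_of_mem self_mem_nhdsWithin fun x hx ↦ ?_
    simp only [mem_ofPred_eq, Function.comp_apply, hxp] at hx ⊢
    exact (h _ hx).ge
  obtain ⟨a, b, hab, hL⟩ := hext.exists_multipliers_of_hasStrictFDerivAt_1d (hc hσ) (hc hf)
  have hL' : ∀ w : TangentSpace I p, a * mvfderiv I σ p w + b * mvfderiv I f p w = 0 := by
    intro w
    rw [mvfderiv_apply_eq_fderiv_extChartAt (hf.mdifferentiableAt one_ne_zero),
      mvfderiv_apply_eq_fderiv_extChartAt (hσ.mdifferentiableAt one_ne_zero)]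
    exact congrArg (fun L ↦ L (mfderiv I 𝓘(ℝ, E) φ p w)) hL
  have hb : b ≠ 0 := by
    rintro rfl
    have ha : a ≠ 0 := fun ha ↦ hab (by simp [ha])
    exact hσp (ContinuousLinearMap.ext fun w ↦ by simpa [ha] using hL' w)
  simpa [hv, hb] using hL' v

/-- Restrict σ to a straight line in a chart along which its derivative is nonzero, and invert the
resulting function of one variable. Such a section transfers smoothness from `M` to functions of the
parameter `s`. -/
theorem exists_local_section [I.Boundaryless] [IsManifold I ∞ M]
    {σ : M → ℝ} {p : M} (hσ : ContMDiffAt I 𝓘(ℝ, ℝ) ∞ σ p) (hσp : mvfderiv I σ p ≠ 0) :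
    ∃ γ : ℝ → M, ContMDiffAt 𝓘(ℝ, ℝ) I ∞ γ (σ p) ∧ ∀ᶠ s in 𝓝 (σ p), σ (γ s) = s := by
  have : IsManifold I 1 M := IsManifold.of_le (n := ∞) (by simp)
  set φ := extChartAt I p with hφ
  have hxt : φ p ∈ φ.target := mem_extChartAt_target p
  have hxp : φ.symm (φ p) = p := extChartAt_to_inv p
  have htn : φ.target ∈ 𝓝 (φ p) := extChartAt_target_mem_nhds p
  have hsymm : ContMDiffAt 𝓘(ℝ, E) I ∞ φ.symm (φ p) :=
    (contMDiffOn_extChartAt_symm p).contMDiffAt htn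
  have hc : ContDiffAt ℝ ∞ (σ ∘ φ.symm) (φ p) := by
    rw [← contMDiffAt_iff_contDiffAt]
    exact ContMDiffAt.comp _ (by rwa [hxp]) hsymm
  have hne : fderiv ℝ (σ ∘ φ.symm) (φ p) ≠ 0 := by
    intro h0
    apply hσp
    ext v
    rw [mvfderiv_apply_eq_fderiv_extChartAt (hσ.mdifferentiableAt (by simp)), ← hφ, h0]
    rfl
  obtain ⟨v, hv⟩ : ∃ v, fderiv ℝ (σ ∘ φ.symm) (φ p) v ≠ 0 := by
    by_contra! h
    exact hne (ContinuousLinearMap.ext h)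
  set c : ℝ → E := fun t ↦ φ p + t • v
  have hcc : ContDiff ℝ ∞ c := by fun_prop
  have hc0 : c 0 = φ p := by simp [c]
  have hg : ContDiffAt ℝ ∞ ((σ ∘ φ.symm) ∘ c) 0 := ContDiffAt.comp 0 (by rwa [hc0]) hcc.contDiffAt
  have hg' : HasDerivAt ((σ ∘ φ.symm) ∘ c) (fderiv ℝ (σ ∘ φ.symm) (φ p) v) 0 := by
    have h1 : HasDerivAt c v 0 := by
      simpa [c] using ((hasDerivAt_id (0 : ℝ)).smul_const v).const_add (φ p)
    have h2 : HasFDerivAt (σ ∘ φ.symm) (fderiv ℝ (σ ∘ φ.symm) (φ p)) (c 0) := by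
      rw [hc0]; exact (hc.differentiableAt (by simp)).hasFDerivAt
    exact h2.comp_hasDerivAt 0 h1
  have hg'' : HasFDerivAt ((σ ∘ φ.symm) ∘ c)
      (ContinuousLinearEquiv.unitsEquivAut ℝ (Units.mk0 _ hv) : ℝ →L[ℝ] ℝ) 0 := by
    refine hg'.hasFDerivAt.congr_fderiv (ContinuousLinearMap.ext fun x ↦ ?_)
    exact ContinuousLinearMap.toSpanSingleton_apply ..
  have hgv : ((σ ∘ φ.symm) ∘ c) 0 = σ p := by simp [hc0, hxp]
  have hinv := hg.to_localInverse hg'' (by simp)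
  have hri := (hg.hasStrictFDerivAt' hg'' (by simp)).eventually_right_inverse
  have hval := hg.localInverse_apply_image hg'' (by simp)
  rw [hgv] at hinv hri hval
  refine ⟨fun s ↦ φ.symm (c (hg.localInverse hg'' (by simp) s)), ?_, hri⟩
  refine ContMDiffAt.comp (σ p) (g := φ.symm) ?_
    ((hcc.contDiffAt.comp (σ p) hinv).contMDiffAt)
  simpa only [Function.comp_apply, hval, hc0] using hsymm

end Calculus

/-! ### Linear algebra of space-like hyperplanes in Minkowski space. -/

section MinkowskiAlgebra

variable {n : ℕ}

/-- The Minkowski scalar product as a continuous bilinear map. -/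
noncomputable def minkL (n : ℕ) : Minkowski n →L[ℝ] Minkowski n →L[ℝ] ℝ :=
  (innerSL ℝ).bilinearComp (.fst ℝ _ ℝ) (.fst ℝ _ ℝ) -
    (ContinuousLinearMap.mul ℝ ℝ).bilinearComp (.snd ℝ _ ℝ) (.snd ℝ _ ℝ)

theorem minkL_apply (x y : Minkowski n) : minkL n x y = mink x y := rfl

theorem mink_comm (x y : Minkowski n) : mink x y = mink y x := by
  simp only [mink, real_inner_comm, mul_comm]

theorem mink_add_left (x y w : Minkowski n) : mink (x + y) w = mink x w + mink y w := by
  simp [← minkL_apply]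

theorem mink_add_right (x y w : Minkowski n) : mink w (x + y) = mink w x + mink w y := by
  simp [← minkL_apply]

theorem mink_sub_left (x y w : Minkowski n) : mink (x - y) w = mink x w - mink y w := by
  simp [← minkL_apply]

theorem mink_sub_right (x y w : Minkowski n) : mink w (x - y) = mink w x - mink w y := by
  simp [← minkL_apply]

theorem mink_neg_left (x w : Minkowski n) : mink (-x) w = -mink x w := by
  simp [← minkL_apply]

theorem mink_neg_right (x w : Minkowski n) : mink w (-x) = -mink w x := by
  simp [← minkL_apply]

theorem mink_smul_left (c : ℝ) (x w : Minkowski n) : mink (c • x) w = c * mink x w := by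
  simp [← minkL_apply]

theorem mink_smul_right (c : ℝ) (x w : Minkowski n) : mink w (c • x) = c * mink w x := by
  simp [← minkL_apply]

theorem mink_zero_left (w : Minkowski n) : mink 0 w = 0 := by
  simp [← minkL_apply]

theorem mink_zero_right (w : Minkowski n) : mink w 0 = 0 := by
  simp [← minkL_apply]

theorem eq_zero_of_mink_eq_zero {x : Minkowski n} (h : ∀ y, mink x y = 0) : x = 0 := by
  -- Reversing the time coordinate makes the product with `x` a sum of squares.
  have h1 := h (x.1, -x.2)
  simp only [mink, real_inner_self_eq_norm_sq, mul_neg, sub_neg_eq_add] at h1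
  have h2 : ‖x.1‖ = 0 := by nlinarith [sq_nonneg ‖x.1‖, mul_self_nonneg x.2]
  have h3 : x.2 = 0 := by nlinarith [sq_nonneg ‖x.1‖, mul_self_nonneg x.2]
  exact Prod.ext (norm_eq_zero.1 h2) h3

variable {T : Type*} [NormedAddCommGroup T] [InnerProductSpace ℝ T] [FiniteDimensional ℝ T]

/-- The adjoint of a linear map `B` from a Euclidean space to Minkowski space. If `B` is isometric,
this is the orthogonal projection to the range of `B`, composed with the inverse of `B`. -/
noncomputable def minkAdjoint (B : T →L[ℝ] Minkowski n) : Minkowski n →L[ℝ] T :=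
  ∑ i, ((minkL n).flip (B (stdOrthonormalBasis ℝ T i))).smulRight (stdOrthonormalBasis ℝ T i)

theorem inner_minkAdjoint (B : T →L[ℝ] Minkowski n) (u : Minkowski n) (v : T) :
    inner ℝ (minkAdjoint B u) v = mink u (B v) := by
  conv_rhs => rw [← (stdOrthonormalBasis ℝ T).sum_repr' v]
  simp [minkAdjoint, sum_inner, inner_smul_left, map_sum, ← minkL_apply, mul_comm]

variable {B : T →L[ℝ] Minkowski n}

theorem minkAdjoint_apply_self (hB : ∀ v w, inner ℝ v w = mink (B v) (B w)) (v : T) :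
    minkAdjoint B (B v) = v :=
  ext_inner_right ℝ fun w ↦ by rw [inner_minkAdjoint, hB]

omit [FiniteDimensional ℝ T] in
theorem injective_coprod_normal (hB : ∀ v w, inner ℝ v w = mink (B v) (B w)) {N : Minkowski n}
    (hN : mink N N = -1) (hNB : ∀ v, mink N (B v) = 0) :
    Function.Injective (B.coprod (ContinuousLinearMap.toSpanSingleton ℝ N)) := by
  rw [injective_iff_map_eq_zero]
  rintro ⟨v, c⟩ h
  simp only [ContinuousLinearMap.coprod_apply, ContinuousLinearMap.toSpanSingleton_apply] at h
  have h1 : mink N (B v + c • N) = 0 := by rw [h, mink_zero_right]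
  rw [mink_add_right, hNB, mink_smul_right, hN] at h1
  have hc : c = 0 := by linarith
  rw [hc, zero_smul, add_zero] at h
  have h2 : inner ℝ v v = (0 : ℝ) := by rw [hB, h, mink_zero_left]
  exact Prod.ext (inner_self_eq_zero.1 h2) hc

/-- The range of `B` and the line of `N` span Minkowski space, so it suffices to check `B v + c •
N`. The plus sign in front of the normal term reflects N·N = -1. -/
theorem apply_minkAdjoint (hB : ∀ v w, inner ℝ v w = mink (B v) (B w)) {N : Minkowski n}
    (hN : mink N N = -1) (hNB : ∀ v, mink N (B v) = 0) (hT : Module.finrank ℝ T = n)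
    (u : Minkowski n) : B (minkAdjoint B u) = u + mink u N • N := by
  have hinj := injective_coprod_normal hB hN hNB
  -- Both sides have dimension n + 1, so injectivity is enough.
  have hsurj : Function.Surjective (B.coprod (ContinuousLinearMap.toSpanSingleton ℝ N)) :=
    (LinearMap.injective_iff_surjective_of_finrank_eq_finrank
      (f := (B.coprod (ContinuousLinearMap.toSpanSingleton ℝ N)).toLinearMap) (by simp [hT])).1 hinj
  obtain ⟨⟨v, c⟩, rfl⟩ := hsurj u
  have h1 : minkAdjoint B N = 0 :=
    ext_inner_right ℝ fun w ↦ by rw [inner_minkAdjoint, hNB, inner_zero_left]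
  simp [minkAdjoint_apply_self hB, h1, mink_add_left, mink_smul_left, mink_comm (B v), hNB, hN]

end MinkowskiAlgebra

/-! ### Differentiating Minkowski products on a manifold. -/

theorem MDifferentiableAt.mink {n : ℕ} {E : Type*} [NormedAddCommGroup E] [NormedSpace ℝ E]
    {H : Type*} [TopologicalSpace H]
    {I : ModelWithCorners ℝ E H} {M : Type*} [TopologicalSpace M] [ChartedSpace H M]
    {f g : M → Minkowski n} {p : M} (hf : MDifferentiableAt I 𝓘(ℝ, Minkowski n) f p)
    (hg : MDifferentiableAt I 𝓘(ℝ, Minkowski n) g p) :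
    MDifferentiableAt I 𝓘(ℝ, ℝ) (fun q ↦ mink (f q) (g q)) p :=
  (((minkL n).mdifferentiable.mdifferentiableAt.comp p hf).clm_apply hg :)

theorem ContMDiffAt.mink {n : ℕ} {E : Type*} [NormedAddCommGroup E] [NormedSpace ℝ E]
    {H : Type*} [TopologicalSpace H] {m : ℕ∞ω}
    {I : ModelWithCorners ℝ E H} {M : Type*} [TopologicalSpace M] [ChartedSpace H M]
    {f g : M → Minkowski n} {p : M} (hf : ContMDiffAt I 𝓘(ℝ, Minkowski n) m f p)
    (hg : ContMDiffAt I 𝓘(ℝ, Minkowski n) m g p) :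
    ContMDiffAt I 𝓘(ℝ, ℝ) m (fun q ↦ mink (f q) (g q)) p :=
  (((minkL n).contMDiff.contMDiffAt.comp p hf).clm_apply hg :)

theorem mvfderiv_mink {n : ℕ} {E : Type*} [NormedAddCommGroup E] [NormedSpace ℝ E]
    {H : Type*} [TopologicalSpace H]
    {I : ModelWithCorners ℝ E H} {M : Type*} [TopologicalSpace M] [ChartedSpace H M]
    {f g : M → Minkowski n} {p : M} (hf : MDifferentiableAt I 𝓘(ℝ, Minkowski n) f p)
    (hg : MDifferentiableAt I 𝓘(ℝ, Minkowski n) g p) (v : TangentSpace I p) :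
    mvfderiv I (fun q ↦ mink (f q) (g q)) p v =
      mink (f p) (mvfderiv I g p v) + mink (mvfderiv I f p v) (g p) :=
  mvfderiv_bilin (minkL n) hf hg v

/-! ### The induced connection, its Levi-Civita property and the Gauss equation. -/

section InducedConnection

variable {n : ℕ} {M : Type*} [TopologicalSpace M] [ChartedSpace (EuclideanSpace ℝ (Fin n)) M]

/-- The image `dZ(W)` of a vector field under the differential of `Z`. -/
noncomputable def pushField (Z : M → Minkowski n) (W : Π p : M, TangentSpace (𝓡 n) p) (p : M) :
    Minkowski n :=
  mvfderiv (𝓡 n) Z p (W p)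

instance (p : M) : FiniteDimensional ℝ (TangentSpace (𝓡 n) p) :=
  inferInstanceAs (FiniteDimensional ℝ (EuclideanSpace ℝ (Fin n)))

theorem finrank_tangentSpace_euclidean (p : M) : Module.finrank ℝ (TangentSpace (𝓡 n) p) = n :=
  finrank_euclideanSpace_fin (𝕜 := ℝ) (n := n)

variable [IsManifold (𝓡 n) ∞ M]

theorem mdifferentiableAt_pushField {Z : M → Minkowski n}
    (hZ : ContMDiff (𝓡 n) 𝓘(ℝ, Minkowski n) ∞ Z) {W : Π p : M, TangentSpace (𝓡 n) p} {p : M}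
    (hW : MDifferentiableAt (𝓡 n) ((𝓡 n).prod 𝓘(ℝ, EuclideanSpace ℝ (Fin n)))
      (fun q ↦ TotalSpace.mk' (EuclideanSpace ℝ (Fin n)) q (W q)) p) :
    MDifferentiableAt (𝓡 n) 𝓘(ℝ, Minkowski n) (pushField Z W) p :=
  (hZ.contMDiffAt.of_le ENat.LEInfty.out).mdifferentiableAt_mvfderiv_apply hW

theorem contMDiffAt_pushField {Z : M → Minkowski n}
    (hZ : ContMDiff (𝓡 n) 𝓘(ℝ, Minkowski n) ∞ Z) {W : Π p : M, TangentSpace (𝓡 n) p} {p : M}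
    (hW : ContMDiffAt (𝓡 n) ((𝓡 n).prod 𝓘(ℝ, EuclideanSpace ℝ (Fin n))) ∞
      (fun q ↦ TotalSpace.mk' (EuclideanSpace ℝ (Fin n)) q (W q)) p) :
    ContMDiffAt (𝓡 n) 𝓘(ℝ, Minkowski n) ∞ (pushField Z W) p :=
  hZ.contMDiffAt.mvfderiv_apply (by simp) hW

variable [RiemannianBundle (fun p : M ↦ TangentSpace (𝓡 n) p)]

/-- The connection induced on a hypersurface of Minkowski space: the tangential component of the
ambient derivative. -/
noncomputable def inducedConnection (Z : M → Minkowski n)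
    (hZ : IsSpacelikeHypersurface Z) :
    CovariantDerivative (𝓡 n) (EuclideanSpace ℝ (Fin n)) (fun p : M ↦ TangentSpace (𝓡 n) p) where
  toFun W p := minkAdjoint (mvfderiv (𝓡 n) Z p) ∘L mvfderiv (𝓡 n) (pushField Z W) p
  isCovariantDerivativeOnUniv :=
    { add := by
        intro W W' p hW hW' _
        have h : pushField Z (W + W') = pushField Z W + pushField Z W' := by
          ext1 q; simp [pushField]
        rw [h, mvfderiv_add (mdifferentiableAt_pushField hZ.smooth hW)
          (mdifferentiableAt_pushField hZ.smooth hW'), ContinuousLinearMap.comp_add]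
      leibniz := by
        intro W g p hW hg _
        have h : pushField Z (g • W) = g • pushField Z W := by
          ext1 q; simp [pushField]
        rw [h, mvfderiv_smul hg (mdifferentiableAt_pushField hZ.smooth hW)]
        ext v
        simp [pushField, minkAdjoint_apply_self (hZ.induced p)] }

variable {Z : M → Minkowski n} (hZ : IsSpacelikeHypersurface Z)

theorem inner_inducedConnection (W : Π p : M, TangentSpace (𝓡 n) p) (p : M)
    (v u : TangentSpace (𝓡 n) p) :
    inner ℝ (inducedConnection Z hZ W p v) u =
      mink (mvfderiv (𝓡 n) (pushField Z W) p v) (mvfderiv (𝓡 n) Z p u) :=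
  inner_minkAdjoint _ _ _

variable [IsContMDiffRiemannianBundle (𝓡 n) ∞ (EuclideanSpace ℝ (Fin n))
      (fun p : M ↦ TangentSpace (𝓡 n) p)]

set_option synthInstance.maxHeartbeats 400000 in
-- Compatibility is the product rule for dZ(V)·dZ(W). Torsion vanishes because dZ[X, Y] is the
-- commutator of the derivatives of Z along X and Y.
theorem isLeviCivita_inducedConnection : IsLeviCivita (inducedConnection Z hZ) := by
  constructor
  · rw [CovariantDerivative.isMetricCompatible_iff]
    intro p X V W hX hV hW
    have h : (fun q ↦ inner ℝ (V q) (W q)) = fun q ↦ mink (pushField Z V q) (pushField Z W q) :=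
      funext fun q ↦ hZ.induced q _ _
    rw [h, mvfderiv_mink (mdifferentiableAt_pushField hZ.smooth hV)
      (mdifferentiableAt_pushField hZ.smooth hW)]
    simp only [inner_inducedConnection]
    rw [real_inner_comm, inner_inducedConnection, mink_comm, add_comm]
    rfl
  · rw [CovariantDerivative.torsion_eq_zero_iff]
    intro X Y p hX hY
    have h := mvfderiv_mlieBracket (hZ.smooth.contMDiffAt.of_le ENat.LEInfty.out) hX hY
    rw [← minkAdjoint_apply_self (hZ.induced p) (VectorField.mlieBracket (𝓡 n) X Y p), h, map_sub]
    rfl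

omit [IsContMDiffRiemannianBundle (𝓡 n) ∞ (EuclideanSpace ℝ (Fin n))
      (fun p : M ↦ TangentSpace (𝓡 n) p)]

/-- The field `N` is a unit normal field of the space-like hypersurface `Z`. -/
structure IsUnitNormal (Z N : M → Minkowski n) : Prop where
  smooth : ContMDiff (𝓡 n) 𝓘(ℝ, Minkowski n) ∞ N
  unit : ∀ p, mink (N p) (N p) = -1
  normal : ∀ p (v : TangentSpace (𝓡 n) p), mink (N p) (mvfderiv (𝓡 n) Z p v) = 0

variable {N : M → Minkowski n} (hN : IsUnitNormal Z N)
include hN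

theorem pushField_inducedConnection (W Y : Π p : M, TangentSpace (𝓡 n) p) (p : M) :
    pushField Z (fun q ↦ inducedConnection Z hZ W q (Y q)) p =
      mvfderiv (𝓡 n) (pushField Z W) p (Y p) +
        mink (mvfderiv (𝓡 n) (pushField Z W) p (Y p)) (N p) • N p :=
  apply_minkAdjoint (hZ.induced p) (hN.unit p) (hN.normal p) (finrank_tangentSpace_euclidean p) _

omit [RiemannianBundle (fun p : M ↦ TangentSpace (𝓡 n) p)] in
theorem mink_mvfderiv_pushField_normal (hZ : ContMDiff (𝓡 n) 𝓘(ℝ, Minkowski n) ∞ Z)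
    {W : Π p : M, TangentSpace (𝓡 n) p} {p : M}
    (hW : MDifferentiableAt (𝓡 n) ((𝓡 n).prod 𝓘(ℝ, EuclideanSpace ℝ (Fin n)))
      (fun q ↦ TotalSpace.mk' (EuclideanSpace ℝ (Fin n)) q (W q)) p) (v : TangentSpace (𝓡 n) p) :
    mink (mvfderiv (𝓡 n) (pushField Z W) p v) (N p) =
      -mink (mvfderiv (𝓡 n) N p v) (mvfderiv (𝓡 n) Z p (W p)) := by
  have h := mvfderiv_mink (hN.smooth.mdifferentiableAt (by simp))
    (mdifferentiableAt_pushField hZ hW) v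
  have h0 : (fun q ↦ mink (N q) (pushField Z W q)) = fun _ ↦ 0 := funext fun q ↦ hN.normal q _
  rw [h0, mvfderiv_const, zero_apply, mink_comm] at h
  exact eq_neg_of_add_eq_zero_left h.symm

/-- The inner covariant derivative is the flat derivative plus a multiple of N. Differentiating
again and projecting, only the term in which N itself is differentiated survives; it is the product
of second fundamental forms. -/
theorem inner_inducedConnection_inducedConnection {W Y : Π p : M, TangentSpace (𝓡 n) p} {p : M}
    (hW : ContMDiffAt (𝓡 n) ((𝓡 n).prod 𝓘(ℝ, EuclideanSpace ℝ (Fin n))) ∞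
      (fun q ↦ TotalSpace.mk' (EuclideanSpace ℝ (Fin n)) q (W q)) p)
    (hY : MDifferentiableAt (𝓡 n) ((𝓡 n).prod 𝓘(ℝ, EuclideanSpace ℝ (Fin n)))
      (fun q ↦ TotalSpace.mk' (EuclideanSpace ℝ (Fin n)) q (Y q)) p)
    (x u : TangentSpace (𝓡 n) p) :
    inner ℝ (inducedConnection Z hZ (fun q ↦ inducedConnection Z hZ W q (Y q)) p x) u =
      mink (mvfderiv (𝓡 n) (fun q ↦ mvfderiv (𝓡 n) (pushField Z W) q (Y q)) p x)
        (mvfderiv (𝓡 n) Z p u) -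
      mink (mvfderiv (𝓡 n) N p (Y p)) (mvfderiv (𝓡 n) Z p (W p)) *
        mink (mvfderiv (𝓡 n) N p x) (mvfderiv (𝓡 n) Z p u) := by
  have hF : ContMDiffAt (𝓡 n) 𝓘(ℝ, Minkowski n) 2 (pushField Z W) p :=
    (contMDiffAt_pushField hZ.smooth hW).of_le ENat.LEInfty.out
  have hG := hF.mdifferentiableAt_mvfderiv_apply hY
  have hNd : MDifferentiableAt (𝓡 n) 𝓘(ℝ, Minkowski n) N p :=
    hN.smooth.mdifferentiableAt (by simp)
  rw [inner_inducedConnection, funext (pushField_inducedConnection hZ hN W Y),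
    mvfderiv_fun_add (g' := fun q ↦ mink (mvfderiv (𝓡 n) (pushField Z W) q (Y q)) (N q) • N q)
      hG ((hG.mink hNd).smul hNd), mvfderiv_fun_smul (hG.mink hNd) hNd,
    mink_mvfderiv_pushField_normal hN hZ.smooth (hW.mdifferentiableAt (by simp))]
  simp [mink_add_left, mink_smul_left, mink_neg_left, hN.normal]
  ring

/-- The Gauss equation for the curvature of vector fields. -/
theorem inner_curvatureField_inducedConnection {X Y W : Π p : M, TangentSpace (𝓡 n) p} {p : M}
    (hX : MDifferentiableAt (𝓡 n) ((𝓡 n).prod 𝓘(ℝ, EuclideanSpace ℝ (Fin n)))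
      (fun q ↦ TotalSpace.mk' (EuclideanSpace ℝ (Fin n)) q (X q)) p)
    (hY : MDifferentiableAt (𝓡 n) ((𝓡 n).prod 𝓘(ℝ, EuclideanSpace ℝ (Fin n)))
      (fun q ↦ TotalSpace.mk' (EuclideanSpace ℝ (Fin n)) q (Y q)) p)
    (hW : ContMDiffAt (𝓡 n) ((𝓡 n).prod 𝓘(ℝ, EuclideanSpace ℝ (Fin n))) ∞
      (fun q ↦ TotalSpace.mk' (EuclideanSpace ℝ (Fin n)) q (W q)) p)
    (u : TangentSpace (𝓡 n) p) :
    inner ℝ (curvatureField (inducedConnection Z hZ) X Y W p) u =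
      mink (mvfderiv (𝓡 n) N p (X p)) (mvfderiv (𝓡 n) Z p (W p)) *
          mink (mvfderiv (𝓡 n) N p (Y p)) (mvfderiv (𝓡 n) Z p u) -
        mink (mvfderiv (𝓡 n) N p (Y p)) (mvfderiv (𝓡 n) Z p (W p)) *
          mink (mvfderiv (𝓡 n) N p (X p)) (mvfderiv (𝓡 n) Z p u) := by
  have hF : ContMDiffAt (𝓡 n) 𝓘(ℝ, Minkowski n) 2 (pushField Z W) p :=
    (contMDiffAt_pushField hZ.smooth hW).of_le ENat.LEInfty.out
  rw [curvatureField, inner_sub_left, inner_sub_left,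
    inner_inducedConnection_inducedConnection hZ hN hW hY,
    inner_inducedConnection_inducedConnection hZ hN hW hX,
    inner_inducedConnection, mvfderiv_mlieBracket hF hX hY, mink_sub_left]
  ring

/-- The Gauss equation. -/
theorem curvatureTensor_inducedConnection (p : M) (x y w u : TangentSpace (𝓡 n) p) :
    curvatureTensor (inducedConnection Z hZ) p x y w u =
      mink (mvfderiv (𝓡 n) N p x) (mvfderiv (𝓡 n) Z p w) *
          mink (mvfderiv (𝓡 n) N p y) (mvfderiv (𝓡 n) Z p u) -
        mink (mvfderiv (𝓡 n) N p y) (mvfderiv (𝓡 n) Z p w) *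
          mink (mvfderiv (𝓡 n) N p x) (mvfderiv (𝓡 n) Z p u) := by
  have h := inner_curvatureField_inducedConnection hZ hN
    (FiberBundle.mdifferentiableAt_extend (𝓡 n) (EuclideanSpace ℝ (Fin n)) x)
    (FiberBundle.mdifferentiableAt_extend (𝓡 n) (EuclideanSpace ℝ (Fin n)) y)
    (FiberBundle.contMDiffAt_extend (𝓡 n) (EuclideanSpace ℝ (Fin n)) w) u
  simp only [FiberBundle.extend_apply_self] at h
  exact h

end InducedConnection

/-! ### Smoothness of a vector field from smoothness of its image. -/

section Smoothness

variable {E : Type*} [NormedAddCommGroup E] [NormedSpace ℝ E] [FiniteDimensional ℝ E]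
  {H : Type*} [TopologicalSpace H]
  {I : ModelWithCorners ℝ E H} {M : Type*} [TopologicalSpace M] [ChartedSpace H M]
  {F : Type*} [NormedAddCommGroup F] [NormedSpace ℝ F] [FiniteDimensional ℝ F]

/-- A vector field is smooth if its image under the differential of a smooth immersion is. -/
theorem contMDiffAt_of_mvfderiv_apply [IsManifold I ∞ M] {f : M → F} {p : M}
    (hf : ContMDiffAt I 𝓘(ℝ, F) ∞ f p) (hinj : Function.Injective (mvfderiv I f p))
    {X : Π q : M, TangentSpace I q}
    (hX : ContMDiffAt I 𝓘(ℝ, F) ∞ (fun q ↦ mvfderiv I f q (X q)) p) :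
    ContMDiffAt I (I.prod 𝓘(ℝ, E)) ∞ (fun q ↦ TotalSpace.mk' E q (X q)) p := by
  have : CompleteSpace E := FiniteDimensional.complete ℝ E
  rw [contMDiffAt_section p]
  set e := trivializationAt E (TangentSpace I) p with he
  have hp : p ∈ e.baseSet := FiberBundle.mem_baseSet_trivializationAt' p
  have hL := hf.mvfderiv_comp_symmL (m := ∞) (by simp)
  set L : M → E →L[ℝ] F := fun q ↦ mvfderiv I f q ∘L e.symmL ℝ q with hLdef
  have hLp : Function.Injective (L p) := by
    refine hinj.comp fun v w hvw ↦ ?_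
    exact ((e.continuousLinearMapAt_symmL (R := ℝ) hp v).symm.trans
      (congrArg (e.continuousLinearMapAt ℝ p) hvw)).trans (e.continuousLinearMapAt_symmL hp w)
  -- With K a left inverse of `L p`, the operator `K ∘L L q` stays invertible for q near p. The
  -- coordinates of X are its inverse applied to K(df(X)), and inversion of operators is smooth.
  obtain ⟨K₀, hK₀⟩ := (L p).toLinearMap.exists_leftInverse_of_injective
    (LinearMap.ker_eq_bot.2 hLp)
  set K : F →L[ℝ] E := K₀.toContinuousLinearMap with hK
  have hKp : K ∘L L p = (ContinuousLinearEquiv.refl ℝ E : E →L[ℝ] E) :=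
    ContinuousLinearMap.ext fun v ↦ LinearMap.congr_fun hK₀ v
  have hKL : ContMDiffAt I 𝓘(ℝ, E →L[ℝ] E) ∞ (fun q ↦ K ∘L L q) p :=
    contMDiffAt_const.clm_comp hL
  have hinv : ContMDiffAt I 𝓘(ℝ, E →L[ℝ] E) ∞ (fun q ↦ (K ∘L L q).inverse) p := by
    refine ContMDiffAt.comp p (g := ContinuousLinearMap.inverse) ?_ hKL
    rw [hKp]
    exact (contDiffAt_map_inverse _).contMDiffAt
  have hKX : ContMDiffAt I 𝓘(ℝ, E) ∞ (fun q ↦ K (mvfderiv I f q (X q))) p :=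
    K.contMDiff.contMDiffAt.comp p hX
  refine (hinv.clm_apply hKX).congr_of_eventuallyEq ?_
  have hev : ∀ᶠ q in 𝓝 p, K ∘L L q ∈ range ((↑) : (E ≃L[ℝ] E) → E →L[ℝ] E) := by
    refine hKL.continuousAt.eventually_mem ?_
    rw [hKp]
    exact ContinuousLinearEquiv.nhds _
  filter_upwards [hev, e.open_baseSet.mem_nhds hp] with q ⟨e', he'⟩ hq
  rw [← he', ContinuousLinearMap.inverse_equiv, ContinuousLinearEquiv.coe_coe,
    ContinuousLinearEquiv.eq_symm_apply, ← ContinuousLinearEquiv.coe_coe, he',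
    ← e.continuousLinearMapAt_apply_of_mem ℝ hq]
  simp only [hLdef, ContinuousLinearMap.comp_apply]
  rw [e.symmL_continuousLinearMapAt hq]

end Smoothness

/-! ### Sectional curvature of a tensor a π + b Φ. -/

section QuasiConstant

variable {n : ℕ} {M : Type*} [TopologicalSpace M] [ChartedSpace (EuclideanSpace ℝ (Fin n)) M]
  [IsManifold (𝓡 n) ∞ M] [RiemannianBundle (fun p : M ↦ TangentSpace (𝓡 n) p)]

/-- The squared norm of the projection of `v` to the plane spanned by `x` and `y`. -/
theorem norm_sq_starProjection_span_pair {T : Type*} [NormedAddCommGroup T] [InnerProductSpace ℝ T]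
    (v x y : T) [(Submodule.span ℝ {x, y}).HasOrthogonalProjection] :
    (inner ℝ x x * inner ℝ y y - inner ℝ x y ^ 2) *
        ‖(Submodule.span ℝ {x, y}).starProjection v‖ ^ 2 =
      inner ℝ y y * inner ℝ v x ^ 2 - 2 * inner ℝ x y * inner ℝ v x * inner ℝ v y +
        inner ℝ x x * inner ℝ v y ^ 2 := by
  obtain ⟨a, b, hab⟩ := Submodule.mem_span_pair.1
    ((Submodule.span ℝ {x, y}).starProjection_apply_mem v)
  have hx : inner ℝ v x = inner ℝ (a • x + b • y) x := by
    rw [hab, Submodule.inner_starProjection_left_eq_right,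
      Submodule.starProjection_eq_self_iff.2 (Submodule.subset_span (by simp))]
  have hy : inner ℝ v y = inner ℝ (a • x + b • y) y := by
    rw [hab, Submodule.inner_starProjection_left_eq_right,
      Submodule.starProjection_eq_self_iff.2 (Submodule.subset_span (by simp))]
  rw [← real_inner_self_eq_norm_sq, ← hab, hx, hy]
  simp only [inner_add_left, inner_add_right, real_inner_smul_left, real_inner_smul_right,
    real_inner_comm x y]
  ring

theorem cos_angle_starProjection {T : Type*} [NormedAddCommGroup T] [InnerProductSpace ℝ T]
    {v : T} (hv : inner ℝ v v = (1 : ℝ)) (U : Submodule ℝ T) [U.HasOrthogonalProjection] :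
    Real.cos (InnerProductGeometry.angle v (U.starProjection v)) = ‖U.starProjection v‖ := by
  have h1 : ‖v‖ = 1 := by
    rw [real_inner_self_eq_norm_sq] at hv
    nlinarith [norm_nonneg v]
  have h2 : inner ℝ v (U.starProjection v) = ‖U.starProjection v‖ ^ 2 := by
    rw [← real_inner_self_eq_norm_sq, Submodule.inner_starProjection_left_eq_right,
      Submodule.starProjection_eq_self_iff.2 (U.starProjection_apply_mem v)]
  rw [InnerProductGeometry.cos_angle, h1, h2, one_mul, pow_two, mul_self_div_self]

/-- If the curvature tensor is `a π + b Φ`, then the sectional curvature of a plane which makes the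
angle `θ` with `ξ` is `a + b cos² θ`. -/
theorem sectionalCurvature_eq_of_curvatureTensor_eq
    (cov : CovariantDerivative (𝓡 n) (EuclideanSpace ℝ (Fin n))
      (fun p : M ↦ TangentSpace (𝓡 n) p)) {p : M} {ξ : TangentSpace (𝓡 n) p}
    (hξ : inner ℝ ξ ξ = (1 : ℝ)) {a b : ℝ}
    (h : ∀ x y w u : TangentSpace (𝓡 n) p,
      curvatureTensor cov p x y w u = a * tensorPi x y w u + b * tensorPhi ξ x y w u)
    {x y : TangentSpace (𝓡 n) p} (hxy : LinearIndependent ℝ ![x, y]) :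
    sectionalCurvature cov p x y = a + b * Real.cos (anglePlane ξ x y) ^ 2 := by
  have : FiniteDimensional ℝ (Submodule.span ℝ {x, y}) :=
    FiniteDimensional.span_of_finite ℝ (by simp)
  -- The Gram determinant of an independent pair does not vanish.
  have hA : inner ℝ x x * inner ℝ y y - inner ℝ x y ^ 2 ≠ (0 : ℝ) := by
    have := Matrix.det_gram_ne_zero_iff_linearIndependent.2 hxy
    simpa [Matrix.det_fin_two, Matrix.gram_apply, real_inner_comm x y, pow_two] using this
  have hP := norm_sq_starProjection_span_pair ξ x y
  have hc : Real.cos (anglePlane ξ x y) = _ :=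
    cos_angle_starProjection hξ (Submodule.span ℝ {x, y})
  rw [hc, sectionalCurvature, h, div_eq_iff hA]
  simp only [tensorPi, tensorPhi]
  rw [real_inner_comm x y]
  linear_combination (-b) * hP

end QuasiConstant

/-! ### The normal N and the direction t - R'N of a canal hypersurface. -/

section Canal

theorem ContDiffAt.deriv_right {F : Type*} [NormedAddCommGroup F] [NormedSpace ℝ F] {f : ℝ → F}
    {s : ℝ} (hf : ContDiffAt ℝ ∞ f s) : ContDiffAt ℝ ∞ (deriv f) s :=
  (hf.fderiv_right (m := ∞) (by simp)).clm_apply contDiffAt_const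

theorem ContDiffAt.mink {n : ℕ} {f g : ℝ → Minkowski n} {s : ℝ} (hf : ContDiffAt ℝ ∞ f s)
    (hg : ContDiffAt ℝ ∞ g s) : ContDiffAt ℝ ∞ (fun s ↦ mink (f s) (g s)) s :=
  ((minkL n).contDiff.contDiffAt.comp s hf).clm_apply hg

variable {n : ℕ} {z : ℝ → Minkowski n} {R : ℝ → ℝ} {s : ℝ}

theorem speed_pos (h : mink (deriv z s) (deriv z s) < 0) : 0 < speed z s :=
  Real.sqrt_pos.2 (by linarith)

theorem speed_smul_unitTangent (h : mink (deriv z s) (deriv z s) < 0) :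
    speed z s • unitTangent z s = deriv z s :=
  smul_inv_smul₀ (speed_pos h).ne' _

theorem mink_unitTangent_self (h : mink (deriv z s) (deriv z s) < 0) :
    mink (unitTangent z s) (unitTangent z s) = -1 := by
  have h1 : speed z s ^ 2 = -mink (deriv z s) (deriv z s) := Real.sq_sqrt (by linarith)
  have h2 := (speed_pos h).ne'
  rw [unitTangent, mink_smul_left, mink_smul_right]
  field_simp
  linarith

theorem contDiffAt_speed (hz : ContDiffAt ℝ ∞ z s) (h : mink (deriv z s) (deriv z s) < 0) :
    ContDiffAt ℝ ∞ (speed z) s :=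
  (hz.deriv_right.mink hz.deriv_right).neg.sqrt (by linarith)

theorem contDiffAt_unitTangent (hz : ContDiffAt ℝ ∞ z s) (h : mink (deriv z s) (deriv z s) < 0) :
    ContDiffAt ℝ ∞ (unitTangent z) s :=
  ((contDiffAt_speed hz h).inv (speed_pos h).ne').smul hz.deriv_right

theorem contDiffAt_derivNatural (hz : ContDiffAt ℝ ∞ z s) (h : mink (deriv z s) (deriv z s) < 0)
    (hR : ContDiffAt ℝ ∞ R s) : ContDiffAt ℝ ∞ (derivNatural z R) s :=
  hR.deriv_right.div (contDiffAt_speed hz h) (speed_pos h).ne'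

variable {M : Type*}

/-- The unit normal `N = -(Z - z) / R` of a canal hypersurface. -/
noncomputable def canalNormal (Z : M → Minkowski n) (σ : M → ℝ) (z : ℝ → Minkowski n) (R : ℝ → ℝ)
    (p : M) : Minkowski n :=
  -(R (σ p))⁻¹ • (Z p - z (σ p))

/-- The vector `t - R' N`, which is tangent to the canal hypersurface and orthogonal to the
generators. -/
noncomputable def canalDirection (Z : M → Minkowski n) (σ : M → ℝ) (z : ℝ → Minkowski n)
    (R : ℝ → ℝ) (p : M) : Minkowski n :=
  unitTangent z (σ p) - derivNatural z R (σ p) • canalNormal Z σ z R p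

variable [TopologicalSpace M] [ChartedSpace (EuclideanSpace ℝ (Fin n)) M]
  [IsManifold (𝓡 n) ∞ M] {Z : M → Minkowski n} {σ : M → ℝ}

/-- The parameter set is open because σ has local sections; hence smoothness of z on it gives
smoothness at each of its points. -/
theorem range_mem_nhds_of_isCanal (hc : IsCanal Z σ z) (p : M) : range σ ∈ 𝓝 (σ p) := by
  obtain ⟨γ, -, hγ⟩ := exists_local_section hc.smooth_param.contMDiffAt (hc.regular_param p)
  filter_upwards [hγ] with s hs using ⟨γ s, hs⟩

variable (hZ : ContMDiff (𝓡 n) 𝓘(ℝ, Minkowski n) ∞ Z) (hc : IsCanal Z σ z) (hR : IsRadius Z σ z R)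
  (he : IsTimelikeCurveOn z (range σ))

omit [IsManifold (𝓡 n) ∞ M] in
include hc in
theorem contMDiff_comp_param {F : Type*} [NormedAddCommGroup F] [NormedSpace ℝ F] {f : ℝ → F}
    (hf : ∀ p, ContDiffAt ℝ ∞ f (σ p)) : ContMDiff (𝓡 n) 𝓘(ℝ, F) ∞ (fun p ↦ f (σ p)) :=
  fun p ↦ (hf p).contMDiffAt.comp p hc.smooth_param.contMDiffAt

omit [IsManifold (𝓡 n) ∞ M] in
include hc in
theorem mvfderiv_comp_param {F : Type*} [NormedAddCommGroup F] [NormedSpace ℝ F] {f : ℝ → F}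
    {p : M} (hf : ContDiffAt ℝ ∞ f (σ p)) (v : TangentSpace (𝓡 n) p) :
    mvfderiv (𝓡 n) (fun p ↦ f (σ p)) p v = mvfderiv (𝓡 n) σ p v • deriv f (σ p) :=
  mvfderiv_deriv_comp (hf.differentiableAt (by simp)) (hc.smooth_param.mdifferentiableAt (by simp))
    v

include hc he

theorem contDiffAt_center (p : M) : ContDiffAt ℝ ∞ z (σ p) :=
  he.1.contDiffAt (range_mem_nhds_of_isCanal hc p)

omit [TopologicalSpace M] [ChartedSpace (EuclideanSpace ℝ (Fin n)) M]
  [IsManifold (𝓡 n) ∞ M] hc in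
theorem mink_deriv_center_neg (p : M) : mink (deriv z (σ p)) (deriv z (σ p)) < 0 :=
  he.2 _ (mem_range_self p)

include hZ hR in
-- Smoothness of R is a consequence, not an assumption: along a local section γ of σ, R = √(-(Z∘γ -
-- z)²), with a positive radicand.
theorem contDiffAt_radius (p : M) : ContDiffAt ℝ ∞ R (σ p) := by
  obtain ⟨γ, hγ, hγσ⟩ := exists_local_section hc.smooth_param.contMDiffAt (hc.regular_param p)
  have hZγ : ContDiffAt ℝ ∞ (fun s ↦ Z (γ s) - z s) (σ p) :=
    (hZ.contMDiffAt.comp _ hγ).contDiffAt.sub (contDiffAt_center hc he p)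
  have hval : ∀ᶠ s in 𝓝 (σ p), 0 < R s ∧ mink (Z (γ s) - z s) (Z (γ s) - z s) = -R s ^ 2 := by
    filter_upwards [hγσ] with s hs
    have := hR (γ s)
    rwa [hs] at this
  obtain ⟨h0, h1⟩ := hval.self_of_nhds
  refine ((hZγ.mink hZγ).neg.sqrt (by rw [h1]; simpa using h0.ne')).congr_of_eventuallyEq ?_
  filter_upwards [hval] with s hs
  rw [hs.2, neg_neg, Real.sqrt_sq hs.1.le]

include hZ hR in
theorem contDiffAt_derivNatural_radius (p : M) : ContDiffAt ℝ ∞ (derivNatural z R) (σ p) :=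
  contDiffAt_derivNatural (contDiffAt_center hc he p) (mink_deriv_center_neg he p)
    (contDiffAt_radius hZ hc hR he p)

include hZ hR

theorem isUnitNormal_canalNormal : IsUnitNormal Z (canalNormal Z σ z R) where
  smooth := by
    have h1 : ContMDiff (𝓡 n) 𝓘(ℝ, ℝ) ∞ (fun p ↦ -(R (σ p))⁻¹) :=
      contMDiff_comp_param hc (f := fun s ↦ -(R s)⁻¹) fun p ↦
        ((contDiffAt_radius hZ hc hR he p).inv (hR p).1.ne').neg
    exact h1.smul (hZ.sub (contMDiff_comp_param hc (contDiffAt_center hc he)))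
  unit p := by
    obtain ⟨h0, h1⟩ := hR p
    have h1' : mink (Z p - z (σ p)) (Z p - z (σ p)) = -R (σ p) ^ 2 := h1
    rw [canalNormal, mink_smul_left, mink_smul_right, h1']
    have := h0.ne'
    field_simp
  normal p v := by
    have h := hc.normals p v
    rw [← neg_sub, mink_neg_left, neg_eq_zero] at h
    rw [canalNormal, mink_smul_left, h, mul_zero]

theorem contMDiff_canalDirection :
    ContMDiff (𝓡 n) 𝓘(ℝ, Minkowski n) ∞ (canalDirection Z σ z R) :=
  (contMDiff_comp_param hc fun p ↦ contDiffAt_unitTangent (contDiffAt_center hc he p)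
    (mink_deriv_center_neg he p)).sub
  ((contMDiff_comp_param hc (contDiffAt_derivNatural_radius hZ hc hR he)).smul
    (isUnitNormal_canalNormal hZ hc hR he).smooth)

/-- The derivative of the unit normal of a canal hypersurface. -/
theorem mvfderiv_canalNormal (p : M) (v : TangentSpace (𝓡 n) p) :
    mvfderiv (𝓡 n) (canalNormal Z σ z R) p v =
      (R (σ p))⁻¹ • (-mvfderiv (𝓡 n) Z p v +
        (mvfderiv (𝓡 n) σ p v * speed z (σ p)) • canalDirection Z σ z R p) := by
  have hN := (isUnitNormal_canalNormal hZ hc hR he).smooth.mdifferentiableAt (x := p) (by simp)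
  have hRs := contDiffAt_radius hZ hc hR he p
  have hRd : MDifferentiableAt (𝓡 n) 𝓘(ℝ, ℝ) (fun p ↦ R (σ p)) p :=
    (contMDiff_comp_param hc (contDiffAt_radius hZ hc hR he)).mdifferentiableAt (by simp)
  have hzd : MDifferentiableAt (𝓡 n) 𝓘(ℝ, Minkowski n) (fun p ↦ z (σ p)) p :=
    (contMDiff_comp_param hc (contDiffAt_center hc he)).mdifferentiableAt (by simp)
  have hZd := hZ.mdifferentiableAt (x := p) (by simp)
  -- Differentiating R N = z - Z avoids the derivative of 1/R.
  have h0 : (fun p ↦ R (σ p) • canalNormal Z σ z R p) = fun p ↦ z (σ p) - Z p := by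
    ext1 q
    rw [canalNormal, smul_smul, mul_neg, mul_inv_cancel₀ (hR q).1.ne', neg_one_smul, neg_sub]
  have h1 := mvfderiv_fun_smul hRd hN
  rw [h0, mvfderiv_fun_sub hzd hZd] at h1
  have h2 := congrArg (fun L ↦ L v) h1
  simp only [sub_apply, add_apply, smul_apply, ContinuousLinearMap.smulRight_apply,
    mvfderiv_comp_param hc hRs, mvfderiv_comp_param hc (contDiffAt_center hc he p)] at h2
  have hsp := speed_pos (mink_deriv_center_neg he p)
  have h3 : deriv R (σ p) = speed z (σ p) * derivNatural z R (σ p) := by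
    rw [derivNatural, mul_div_cancel₀ _ hsp.ne']
  rw [← speed_smul_unitTangent (mink_deriv_center_neg he p), h3] at h2
  rw [eq_inv_smul_iff₀ (hR p).1.ne', canalDirection, ← sub_eq_iff_eq_add.2 h2]
  module

/-- Since N·N is constant, N·dN = 0. In dN the dZ part is orthogonal to N, and a vector on which dσ
does not vanish isolates the remaining term. -/
theorem mink_canalNormal_canalDirection (p : M) :
    mink (canalNormal Z σ z R p) (canalDirection Z σ z R p) = 0 := by
  have hN := isUnitNormal_canalNormal hZ hc hR he
  have hNd := hN.smooth.mdifferentiableAt (x := p) (by simp)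
  obtain ⟨v, hv⟩ : ∃ v, mvfderiv (𝓡 n) σ p v ≠ 0 := by
    by_contra! h
    exact hc.regular_param p (ContinuousLinearMap.ext h)
  have h := mvfderiv_mink hNd hNd v
  rw [funext hN.unit, mvfderiv_const, zero_apply, mink_comm (mvfderiv (𝓡 n) _ p v),
    mvfderiv_canalNormal hZ hc hR he, mink_smul_right, mink_add_right, mink_neg_right, hN.normal,
    mink_smul_right] at h
  have hsp := (speed_pos (mink_deriv_center_neg he p)).ne'
  have hR0 := (hR p).1.ne'
  have h' : (R (σ p))⁻¹ * (mvfderiv (𝓡 n) σ p v * speed z (σ p)) *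
    mink (canalNormal Z σ z R p) (canalDirection Z σ z R p) = 0 := by linarith
  simpa [hv, hsp, hR0] using h'

theorem mink_unitTangent_canalNormal (p : M) :
    mink (unitTangent z (σ p)) (canalNormal Z σ z R p) = -derivNatural z R (σ p) := by
  have h := mink_canalNormal_canalDirection hZ hc hR he p
  rw [canalDirection, mink_sub_right, mink_smul_right,
    (isUnitNormal_canalNormal hZ hc hR he).unit, mink_comm] at h
  linarith

theorem mink_unitTangent_canalDirection (p : M) :
    mink (unitTangent z (σ p)) (canalDirection Z σ z R p) = derivNatural z R (σ p) ^ 2 - 1 := by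
  rw [canalDirection, mink_sub_right, mink_smul_right,
    mink_unitTangent_canalNormal hZ hc hR he, mink_unitTangent_self (mink_deriv_center_neg he p)]
  ring

theorem mink_canalDirection_self (p : M) :
    mink (canalDirection Z σ z R p) (canalDirection Z σ z R p) =
      derivNatural z R (σ p) ^ 2 - 1 := by
  conv_lhs => enter [1]; rw [canalDirection]
  rw [mink_sub_left, mink_smul_left, mink_canalNormal_canalDirection hZ hc hR he,
    mink_unitTangent_canalDirection hZ hc hR he, mul_zero, sub_zero]

/-- The derivative of `t - R' N` in the directions tangent to the generators. -/
theorem mvfderiv_canalDirection {p : M} {v : TangentSpace (𝓡 n) p}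
    (hv : mvfderiv (𝓡 n) σ p v = 0) :
    mvfderiv (𝓡 n) (canalDirection Z σ z R) p v =
      (derivNatural z R (σ p) / R (σ p)) • mvfderiv (𝓡 n) Z p v := by
  have hN := (isUnitNormal_canalNormal hZ hc hR he).smooth.mdifferentiableAt (x := p) (by simp)
  have ht (p : M) := contDiffAt_unitTangent (contDiffAt_center hc he p) (mink_deriv_center_neg he p)
  have hρ := contDiffAt_derivNatural_radius hZ hc hR he
  have hρd : MDifferentiableAt (𝓡 n) 𝓘(ℝ, ℝ) (fun p ↦ derivNatural z R (σ p)) p :=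
    (contMDiff_comp_param hc hρ).mdifferentiableAt (by simp)
  have htd : MDifferentiableAt (𝓡 n) 𝓘(ℝ, Minkowski n) (fun p ↦ unitTangent z (σ p)) p :=
    (contMDiff_comp_param hc ht).mdifferentiableAt (by simp)
  have h1 : mvfderiv (𝓡 n) (canalDirection Z σ z R) p = _ :=
    mvfderiv_fun_sub htd (hρd.smul hN)
  rw [h1, mvfderiv_fun_smul hρd hN]
  simp only [sub_apply, add_apply, smul_apply, ContinuousLinearMap.smulRight_apply,
    mvfderiv_comp_param hc (hρ p), mvfderiv_comp_param hc (ht p),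
    mvfderiv_canalNormal hZ hc hR he, hv]
  module

end Canal

/-! ### The field t - R'N on M, the bound R'² > 1, and the gradient of σ. -/

section Main

variable {n : ℕ} {M : Type*} [TopologicalSpace M] [ChartedSpace (EuclideanSpace ℝ (Fin n)) M]
  [IsManifold (𝓡 n) ∞ M] [RiemannianBundle (fun p : M ↦ TangentSpace (𝓡 n) p)]
  {Z : M → Minkowski n} {σ : M → ℝ} {z : ℝ → Minkowski n} {R : ℝ → ℝ}

/-- The tangent vector field represented by `t - R' N`. -/
noncomputable def canalField (Z : M → Minkowski n) (σ : M → ℝ) (z : ℝ → Minkowski n) (R : ℝ → ℝ)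
    (p : M) : TangentSpace (𝓡 n) p :=
  minkAdjoint (mvfderiv (𝓡 n) Z p) (canalDirection Z σ z R p)

omit [IsManifold (𝓡 n) ∞ M] in
theorem IsSpacelikeHypersurface.injective_mvfderiv (hZ : IsSpacelikeHypersurface Z) (p : M) :
    Function.Injective (mvfderiv (𝓡 n) Z p) :=
  Function.LeftInverse.injective (g := minkAdjoint (mvfderiv (𝓡 n) Z p))
    (minkAdjoint_apply_self (hZ.induced p))

variable (hZ : IsSpacelikeHypersurface Z) (hc : IsCanal Z σ z) (hR : IsRadius Z σ z R)
  (he : IsTimelikeCurveOn z (range σ))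

include hZ hc hR he

theorem mvfderiv_canalField (p : M) :
    mvfderiv (𝓡 n) Z p (canalField Z σ z R p) = canalDirection Z σ z R p := by
  have hN := isUnitNormal_canalNormal hZ.smooth hc hR he
  rw [canalField, apply_minkAdjoint (hZ.induced p) (hN.unit p) (hN.normal p)
    (finrank_tangentSpace_euclidean p), mink_comm,
    mink_canalNormal_canalDirection hZ.smooth hc hR he, zero_smul, add_zero]

theorem inner_canalField_self (p : M) :
    inner ℝ (canalField Z σ z R p) (canalField Z σ z R p) = derivNatural z R (σ p) ^ 2 - 1 := by
  rw [hZ.induced, mvfderiv_canalField hZ hc hR he, mink_canalDirection_self hZ.smooth hc hR he]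

theorem contMDiff_canalField :
    ContMDiff (𝓡 n) ((𝓡 n).prod 𝓘(ℝ, EuclideanSpace ℝ (Fin n))) ∞
      (fun p ↦ TotalSpace.mk' (EuclideanSpace ℝ (Fin n)) p (canalField Z σ z R p)) := fun p ↦
  contMDiffAt_of_mvfderiv_apply hZ.smooth.contMDiffAt (hZ.injective_mvfderiv p)
    (by
      simp only [mvfderiv_canalField hZ hc hR he]
      exact (contMDiff_canalDirection hZ.smooth hc hR he).contMDiffAt)

/-- `R'² > 1`: otherwise `N = ± t` would be constant along a generator, which would be a point. -/
theorem derivNatural_radius_sq_sub_one_pos (hn : 2 ≤ n) (p : M) :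
    0 < derivNatural z R (σ p) ^ 2 - 1 := by
  refine lt_of_le_of_ne ?_ fun h0 ↦ ?_
  · rw [← inner_canalField_self hZ hc hR he p]
    exact real_inner_self_nonneg
  obtain ⟨v, hv, hv0⟩ : ∃ v : TangentSpace (𝓡 n) p, mvfderiv (𝓡 n) σ p v = 0 ∧ v ≠ 0 := by
    have h := LinearMap.ker_ne_bot_of_finrank_lt (f := (mvfderiv (𝓡 n) σ p).toLinearMap)
      (by rw [finrank_tangentSpace_euclidean, Module.finrank_self]; omega)
    obtain ⟨v, hv, hv0⟩ := Submodule.exists_mem_ne_zero_of_ne_bot h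
    exact ⟨v, hv, hv0⟩
  -- R'² - 1 depends on σ only, so its vanishing at `p` spreads over the generator; positive
  -- definiteness of g then kills the field there.
  have hlevel : ∀ q, σ q = σ p → canalDirection Z σ z R q = 0 := by
    intro q hq
    have h1 := inner_canalField_self hZ hc hR he q
    rw [hq, ← h0, inner_self_eq_zero] at h1
    rw [← mvfderiv_canalField hZ hc hR he, h1, map_zero]
  have hG := contMDiff_canalDirection hZ.smooth hc hR he
  have hdG : mvfderiv (𝓡 n) (canalDirection Z σ z R) p v = 0 := by
    refine eq_zero_of_mink_eq_zero fun e ↦ ?_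
    have hGe : ContMDiffAt (𝓡 n) 𝓘(ℝ, ℝ) ∞ (fun q ↦ mink (canalDirection Z σ z R q) e) p :=
      hG.contMDiffAt.mink contMDiffAt_const
    have h1 := mvfderiv_eq_zero_of_eqOn_level (hGe.of_le (by simp))
      (hc.smooth_param.contMDiffAt.of_le (by simp)) (hc.regular_param p)
      (fun q hq ↦ by rw [hlevel q hq, hlevel p rfl]) v hv
    rwa [mvfderiv_mink (hG.mdifferentiableAt (by simp)) mdifferentiableAt_const, mvfderiv_const,
      zero_apply, mink_zero_right, zero_add] at h1
  rw [mvfderiv_canalDirection hZ.smooth hc hR he hv, smul_eq_zero, div_eq_zero_iff] at hdG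
  have hρ : derivNatural z R (σ p) ≠ 0 := by
    intro h
    rw [h] at h0
    norm_num at h0
  rcases hdG with (h | h) | h
  · exact hρ h
  · exact (hR p).1.ne' h
  · exact hv0 (hZ.injective_mvfderiv p (h.trans (map_zero _).symm))

/-- The gradient of the parameter `σ` is a multiple of the field `t - R' N`. -/
theorem exists_mvfderiv_param_eq (hn : 2 ≤ n) (p : M) : ∃ c : ℝ, c ≠ 0 ∧
    ∀ v, mvfderiv (𝓡 n) σ p v = c * inner ℝ (canalField Z σ z R p) v := by
  have hN := isUnitNormal_canalNormal hZ.smooth hc hR he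
  have hNd := hN.smooth.mdifferentiableAt (x := p) (by simp)
  have ht (p : M) := contDiffAt_unitTangent (contDiffAt_center hc he p) (mink_deriv_center_neg he p)
  have htd : MDifferentiableAt (𝓡 n) 𝓘(ℝ, Minkowski n) (fun p ↦ unitTangent z (σ p)) p :=
    (contMDiff_comp_param hc ht).mdifferentiableAt (by simp)
  have hρ := contDiffAt_derivNatural_radius hZ.smooth hc hR he
  have hR0 := (hR p).1.ne'
  obtain ⟨μ, hμ⟩ : ∃ μ : ℝ, ∀ v, inner ℝ (canalField Z σ z R p) v = mvfderiv (𝓡 n) σ p v * μ := by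
    -- This factor is found by differentiating t·N = -R' in the direction `v` and solving for
    -- t·dZ(v), which equals the inner product on the left because N is normal.
    refine ⟨speed z (σ p) * (derivNatural z R (σ p) ^ 2 - 1) + R (σ p) *
      (mink (deriv (unitTangent z) (σ p)) (canalNormal Z σ z R p) +
        deriv (derivNatural z R) (σ p)), fun v ↦ ?_⟩
    have h := mvfderiv_mink htd hNd v
    rw [funext (mink_unitTangent_canalNormal hZ.smooth hc hR he),
      mvfderiv_comp_param hc (f := fun s ↦ -derivNatural z R s) (hρ p).neg,
      mvfderiv_comp_param hc (ht p), mvfderiv_canalNormal hZ.smooth hc hR he, deriv.fun_neg] at h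
    simp only [mink_smul_left, mink_smul_right, mink_add_right, mink_neg_right,
      mink_unitTangent_canalDirection hZ.smooth hc hR he, smul_eq_mul] at h
    have h2 : inner ℝ (canalField Z σ z R p) v =
        mink (unitTangent z (σ p)) (mvfderiv (𝓡 n) Z p v) := by
      rw [hZ.induced, mvfderiv_canalField hZ hc hR he, canalDirection, mink_sub_left,
        mink_smul_left, hN.normal, mul_zero, sub_zero]
    rw [h2]
    field_simp at h
    linarith
  have hψ := derivNatural_radius_sq_sub_one_pos hZ hc hR he hn p
  -- Evaluating on the field itself gives R'² - 1 > 0 on the left, so μ cannot vanish.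
  have h1 := hμ (canalField Z σ z R p)
  rw [inner_canalField_self hZ hc hR he] at h1
  have hμ0 : μ ≠ 0 := by
    rintro rfl
    linarith
  exact ⟨μ⁻¹, inv_ne_zero hμ0, fun v ↦ by rw [hμ]; field_simp⟩

end Main

theorem proposition3p6 {n : ℕ} (hn : 4 ≤ n)
    {M : Type*} [TopologicalSpace M] [ChartedSpace (EuclideanSpace ℝ (Fin n)) M]
    [IsManifold (𝓡 n) ∞ M]
    [RiemannianBundle (fun p : M ↦ TangentSpace (𝓡 n) p)]
    [IsContMDiffRiemannianBundle (𝓡 n) ∞ (EuclideanSpace ℝ (Fin n))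
      (fun p : M ↦ TangentSpace (𝓡 n) p)]
    (Z : M → Minkowski n) (σ : M → ℝ) (z : ℝ → Minkowski n) (R : ℝ → ℝ)
    (hZ : IsSpacelikeHypersurface Z)
    (hcanal : IsCanal Z σ z)
    (hR : IsRadius Z σ z R)
    (helliptic : IsTimelikeCurveOn z (range σ)) :
    ∃ (cov : CovariantDerivative (𝓡 n) (EuclideanSpace ℝ (Fin n))
        (fun p : M ↦ TangentSpace (𝓡 n) p))
      (ξ : Π p : M, TangentSpace (𝓡 n) p) (a b k : M → ℝ),
      (∀ p, 0 < derivNatural z R (σ p) ^ 2 - 1 ∧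
        mvfderiv (𝓡 n) Z p (ξ p) =
          (√(derivNatural z R (σ p) ^ 2 - 1))⁻¹ •
            (unitTangent z (σ p) -
              derivNatural z R (σ p) • (-(R (σ p))⁻¹ • (Z p - z (σ p))))) ∧
      IsQCManifold cov ξ ∧
      AreQCFunctions cov ξ a b k ∧
      (∀ p, a p = -1 / R (σ p) ^ 2 ∧ a p < 0) ∧
      (∀ p, a p + k p ^ 2 = 1 / (R (σ p) ^ 2 * (derivNatural z R (σ p) ^ 2 - 1)) ∧
        0 < a p + k p ^ 2) := by
  have hn2 : 2 ≤ n := by omega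
  have hψ := derivNatural_radius_sq_sub_one_pos hZ hcanal hR helliptic hn2
  have hN := isUnitNormal_canalNormal hZ.smooth hcanal hR helliptic
  have hRs := contDiffAt_radius hZ.smooth hcanal hR helliptic
  have hρ := contDiffAt_derivNatural_radius hZ.smooth hcanal hR helliptic
  choose c hc0 hc using exists_mvfderiv_param_eq hZ hcanal hR helliptic hn2
  set g := canalField Z σ z R with hg
  set w : ℝ → ℝ := fun s ↦ (√(derivNatural z R s ^ 2 - 1))⁻¹ with hw
  have hws (p : M) : ContDiffAt ℝ ∞ w (σ p) :=
    ((((hρ p).pow 2).sub contDiffAt_const).sqrt (hψ p).ne').inv (Real.sqrt_pos.2 (hψ p)).ne'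
  have hw2 (p : M) : w (σ p) ^ 2 * (derivNatural z R (σ p) ^ 2 - 1) = 1 := by
    rw [hw, inv_pow, Real.sq_sqrt (hψ p).le, inv_mul_cancel₀ (hψ p).ne']
  have hwpos (p : M) : 0 < w (σ p) := inv_pos.2 (Real.sqrt_pos.2 (hψ p))
  have hsp (p : M) := speed_pos (mink_deriv_center_neg helliptic p)
  set ξ : Π p : M, TangentSpace (𝓡 n) p := fun p ↦ w (σ p) • g p with hξ
  have hZξ (p : M) : mvfderiv (𝓡 n) Z p (ξ p) = w (σ p) • canalDirection Z σ z R p := by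
    rw [hξ, map_smul, mvfderiv_canalField hZ hcanal hR helliptic]
  have hξu (p : M) : inner ℝ (ξ p) (ξ p) = (1 : ℝ) := by
    simp only [hξ, real_inner_smul_left, real_inner_smul_right]
    rw [inner_canalField_self hZ hcanal hR helliptic]
    linear_combination hw2 p
  have hσξ (p : M) (v : TangentSpace (𝓡 n) p) :
      w (σ p) * mvfderiv (𝓡 n) σ p v = c p * inner ℝ (ξ p) v := by
    rw [hc, hξ, real_inner_smul_left]
    ring
  set a : M → ℝ := fun p ↦ -1 / R (σ p) ^ 2 with ha
  -- The η⊗η coefficient of the second fundamental form is b R. The factor R'² - 1 appears on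
  -- replacing t - R'N by the unit field ξ in both slots.
  set b : M → ℝ := fun p ↦
    speed z (σ p) * c p * (derivNatural z R (σ p) ^ 2 - 1) / R (σ p) ^ 2 with hb
  set k : M → ℝ := fun p ↦ derivNatural z R (σ p) / R (σ p) * w (σ p) with hk
  have hcurv (p : M) (x y v u : TangentSpace (𝓡 n) p) :
      curvatureTensor (inducedConnection Z hZ) p x y v u =
        a p * tensorPi x y v u + b p * tensorPhi (ξ p) x y v u := by
    have hh (x y : TangentSpace (𝓡 n) p) :
        mink (mvfderiv (𝓡 n) (canalNormal Z σ z R) p x) (mvfderiv (𝓡 n) Z p y) =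
          (R (σ p))⁻¹ * (-inner ℝ x y + speed z (σ p) * c p *
            (derivNatural z R (σ p) ^ 2 - 1) * (inner ℝ (ξ p) x * inner ℝ (ξ p) y)) := by
      rw [mvfderiv_canalNormal hZ.smooth hcanal hR helliptic, mink_smul_left, mink_add_left,
        mink_neg_left, mink_smul_left, ← mvfderiv_canalField hZ hcanal hR helliptic,
        ← hZ.induced, ← hZ.induced, hc]
      simp only [hξ, real_inner_smul_left]
      linear_combination (-(R (σ p))⁻¹ * speed z (σ p) * c p * inner ℝ (g p) x *
        inner ℝ (g p) y) * hw2 p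
    rw [curvatureTensor_inducedConnection hZ hN]
    simp only [hh, tensorPi, tensorPhi, ha, hb]
    have := (hR p).1.ne'
    field_simp
    ring
  refine ⟨inducedConnection Z hZ, ξ, a, b, k, fun p ↦ ⟨hψ p, hZξ p⟩, ?_, ?_, ?_, ?_⟩
  · refine ⟨isLeviCivita_inducedConnection hZ, ?_, hξu,
      fun p θ ↦ a p + b p * Real.cos θ ^ 2, fun p x y hxy ↦
        sectionalCurvature_eq_of_curvatureTensor_eq _ (hξu p) (hcurv p) hxy⟩
    exact (contMDiff_comp_param hcanal hws).smul_section
      (contMDiff_canalField hZ hcanal hR helliptic)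
  · refine ⟨hcurv, fun p ↦ ?_, fun p x hx ↦ ?_, fun p ↦ ?_⟩
    · exact div_ne_zero (mul_ne_zero (mul_ne_zero (hsp p).ne' (hc0 p)) (hψ p).ne')
        (pow_ne_zero 2 (hR p).1.ne')
    -- Vectors orthogonal to ξ are tangent to the generator, so the normalizing factor `w ∘ σ` is
    -- not differentiated and only the derivative of t - R'N enters.
    · have hσx : mvfderiv (𝓡 n) σ p x = 0 := by
        have := hσξ p x
        rw [hx, mul_zero] at this
        exact (mul_eq_zero.1 this).resolve_left (hwpos p).ne'
      have hG := contMDiff_canalDirection hZ.smooth hcanal hR helliptic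
      have hder : mvfderiv (𝓡 n) (pushField Z ξ) p x = k p • mvfderiv (𝓡 n) Z p x := by
        have h1 : pushField Z ξ = fun p ↦ w (σ p) • canalDirection Z σ z R p := funext hZξ
        rw [h1, mvfderiv_fun_smul ((contMDiff_comp_param hcanal hws).mdifferentiableAt (by simp))
          (hG.mdifferentiableAt (by simp))]
        simp only [add_apply, smul_apply, ContinuousLinearMap.smulRight_apply,
          mvfderiv_comp_param hcanal (hws p), hσx,
          mvfderiv_canalDirection hZ.smooth hcanal hR helliptic hσx, hk]
        module
      refine ext_inner_right ℝ fun u ↦ ?_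
      rw [inner_inducedConnection, hder, real_inner_smul_left, hZ.induced, mink_smul_left]
    · have hR0 := (hR p).1.ne'
      have haD : HasDerivAt (fun s ↦ -1 / R s ^ 2) (2 * deriv R (σ p) / R (σ p) ^ 3) (σ p) := by
        have h1 := ((hRs p).differentiableAt (by simp)).hasDerivAt
        refine ((hasDerivAt_const (σ p) (-1 : ℝ)).div (h1.pow 2) (pow_ne_zero 2 hR0)).congr_deriv ?_
        simp only [Pi.pow_apply]
        field_simp
        simp
        ring
      have hda : mvfderiv (𝓡 n) a p (ξ p) =
          mvfderiv (𝓡 n) σ p (ξ p) * (2 * deriv R (σ p) / R (σ p) ^ 3) := by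
        rw [← haD.deriv, ← smul_eq_mul]
        exact mvfderiv_deriv_comp haD.differentiableAt
          (hcanal.smooth_param.mdifferentiableAt (by simp)) _
      have h1 := hσξ p (ξ p)
      rw [hξu, mul_one] at h1
      have h3 : deriv R (σ p) = speed z (σ p) * derivNatural z R (σ p) := by
        rw [derivNatural, mul_div_cancel₀ _ (hsp p).ne']
      have hb0 : b p ≠ 0 := div_ne_zero (mul_ne_zero (mul_ne_zero (hsp p).ne' (hc0 p)) (hψ p).ne')
        (pow_ne_zero 2 hR0)
      rw [hda, h3, eq_div_iff (mul_ne_zero two_ne_zero hb0)]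
      -- Substituting c = w dσ(ξ) into b leaves the factor w² (R'² - 1), which is 1.
      linear_combination (-2 * speed z (σ p) * derivNatural z R (σ p) / R (σ p) ^ 3) *
        ((derivNatural z R (σ p) ^ 2 - 1) * w (σ p) * h1 - mvfderiv (𝓡 n) σ p (ξ p) * hw2 p)
  · exact fun p ↦ ⟨rfl, div_neg_of_neg_of_pos (by norm_num) (pow_pos (hR p).1 2)⟩
  · intro p
    have h1 : a p + k p ^ 2 = 1 / (R (σ p) ^ 2 * (derivNatural z R (σ p) ^ 2 - 1)) := by
      have := (hR p).1.ne'
      have := (hψ p).ne'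
      have h2 : w (σ p) ^ 2 = (derivNatural z R (σ p) ^ 2 - 1)⁻¹ :=
        eq_inv_of_mul_eq_one_left (hw2 p)
      simp only [ha, hk, mul_pow, h2]
      field_simp
      ring
    exact ⟨h1, h1 ▸ one_div_pos.2 (mul_pos (pow_pos (hR p).1 2) (hψ p))⟩
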